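/- Let $d$ and $p,q$ be positive integers with $q\le p-1$. For $m\in\mathbb{Z}_+$ and real-valued Schwartz functions $\phi,\psi\in\mathcal{S}(\mathbb{R}^d)$ put $$\langle\phi,\psi\rangle_m:=\sum_{|\alpha|+|\beta|\le 2m}\int_{\mathbb{R}^d}x^\alpha\partial^\beta\phi(x)\,x^\alpha\partial^\beta\psi(x)\,dx,\qquad \|\phi\|_m^2:=\langle\phi,\phi\rangle_m ,$$ where $\alpha,\beta\in\mathbb{Z}_+^d$, and let $\mathcal{S}_m(\mathbb{R}^d)\subset\mathcal{S}'(\mathbb{R}^d)$ be the Hermite--Sobolev space, the completion of $\mathcal{S}(\mathbb{R}^d)$ in $\|\cdot\|_m$, with the extended inner product and norm; thus $\mathcal{S}_p(\mathbb{R}^d)\subset\mathcal{S}_q(\mathbb{R}^d)$. Let $\sigma_{ij},h_j,g:\mathbb{R}^d\to\mathbb{R}$ $(1\le i,j\le d)$ be bounded smooth functions all of whose derivatives are bounded, and let $f_j:\mathbb{R}^d\to\mathbb{R}$ $(1\le j\le d)$ be smooth functions all of whose derivatives of order at least one are bounded. With $\sigma=(\sigma_{ij})$, define for $\phi\in\mathcal{S}'(\mathbb{R}^d)$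 (derivatives and products with functions being defined by duality) $$A_i\phi:=\sum_{j=1}^d\sigma_{ji}\,\partial_j\phi+h_i\phi,\quad i=1,\dots,d,\qquad L\phi:=\frac12\sum_{i,j=1}^d(\sigma\sigma^t)_{ij}\,\partial^2_{ij}\phi+\sum_{j=1}^d f_j\,\partial_j\phi+g\phi .$$ Then there is a constant $C>0$, depending on $d,p,q,\sigma,f,g,h$ but not on $\phi$, such that for every $\phi\in\mathcal{S}_p(\mathbb{R}^d)$ the distributions $L\phi,A_1\phi,\dots,A_d\phi$ belong to $\mathcal{S}_q(\mathbb{R}^d)$ and $$2\langle\phi,L\phi\rangle_q+\sum_{i=1}^d\|A_i\phi\|_q^2\le C\|\phi\|_q^2 .$$ -/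

import Mathlib

noncomputable section

namespace HermiteSobolev

open MeasureTheory SchwartzMap LineDeriv
open scoped ContDiff

/-! ### Schwartz functions and the inner products `⟨·,·⟩_p` -/

/-- The Euclidean space `ℝᵈ`. -/
abbrev E (d : ℕ) : Type := EuclideanSpace ℝ (Fin d)

/-- The monomial `x^α = ∏ᵢ xᵢ^{αᵢ}`. -/
def monomial {d : ℕ} (α : Fin d → ℕ) (x : E d) : ℝ := ∏ i, x i ^ α i

/-- The partial derivative `∂ⱼ : 𝓢(ℝᵈ) → 𝓢(ℝᵈ)`. -/
def pderiv {d : ℕ} (j : Fin d) : 𝓢(E d, ℝ) →L[ℝ] 𝓢(E d, ℝ) :=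
  lineDerivOpCLM ℝ 𝓢(E d, ℝ) (EuclideanSpace.single j (1 : ℝ))

/-- The iterated partial derivative `∂^β = ∂₁^{β₁} ⋯ ∂_d^{β_d} : 𝓢(ℝᵈ) → 𝓢(ℝᵈ)`. -/
def mderiv {d : ℕ} (β : Fin d → ℕ) : 𝓢(E d, ℝ) →L[ℝ] 𝓢(E d, ℝ) :=
  ((List.finRange d).map fun j => pderiv j ^ β j).prod

/-- The finite set of pairs of multi-indices `(α, β)` with `|α| + |β| ≤ 2p`. -/
def indexSet (d p : ℕ) : Finset ((Fin d → ℕ) × (Fin d → ℕ)) :=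
  (Finset.Iic (fun _ => 2 * p) ×ˢ Finset.Iic (fun _ => 2 * p)).filter
    fun ab => ∑ i, ab.1 i + ∑ i, ab.2 i ≤ 2 * p

/-- `⟨φ, ψ⟩_p = ∑_{|α|+|β| ≤ 2p} ∫ x^α ∂^β φ(x) · x^α ∂^β ψ(x) dx`. -/
def schwartzInner {d : ℕ} (p : ℕ) (φ ψ : 𝓢(E d, ℝ)) : ℝ :=
  ∑ ab ∈ indexSet d p,
    ∫ x, (monomial ab.1 x * mderiv ab.2 φ x) * (monomial ab.1 x * mderiv ab.2 ψ x)

theorem mem_indexSet {d p : ℕ} (α β : Fin d → ℕ) :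
    (α, β) ∈ indexSet d p ↔ ∑ i, α i + ∑ i, β i ≤ 2 * p := by
  simp only [indexSet, Finset.mem_filter, Finset.mem_product, Finset.mem_Iic, and_iff_right_iff_imp]
  intro h
  refine ⟨fun i => ?_, fun i => ?_⟩
  · have := Finset.single_le_sum (f := α) (fun _ _ => Nat.zero_le _) (Finset.mem_univ i)
    simp only
    omega
  · have := Finset.single_le_sum (f := β) (fun _ _ => Nat.zero_le _) (Finset.mem_univ i)
    simp only
    omega

theorem indexSet_mono {d p q : ℕ} (h : q ≤ p) : indexSet d q ⊆ indexSet d p := by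
  rintro ⟨α, β⟩ hab
  rw [mem_indexSet] at hab ⊢
  omega

theorem pderiv_apply {d : ℕ} (j : Fin d) (φ : 𝓢(E d, ℝ)) (x : E d) :
    pderiv j φ x = fderiv ℝ φ x (EuclideanSpace.single j 1) := rfl

theorem mderiv_zero {d : ℕ} : mderiv (0 : Fin d → ℕ) = ContinuousLinearMap.id ℝ 𝓢(E d, ℝ) := by
  have : ∀ l : List (Fin d), (l.map fun j => pderiv j ^ (0 : Fin d → ℕ) j).prod
      = (1 : 𝓢(E d, ℝ) →L[ℝ] 𝓢(E d, ℝ)) := by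
    intro l
    induction l with
    | nil => rfl
    | cons a l ih => simp
  exact this _

theorem monomial_hasTemperateGrowth {d : ℕ} (α : Fin d → ℕ) :
    (monomial α).HasTemperateGrowth := by
  unfold monomial
  have h : ∀ s : Finset (Fin d), (fun x : E d => ∏ i ∈ s, x i ^ α i).HasTemperateGrowth := by
    intro s
    induction s using Finset.induction_on with
    | empty => simp
    | insert a s ha ih =>
      simp only [Finset.prod_insert ha]
      exact (((EuclideanSpace.proj a : E d →L[ℝ] ℝ).hasTemperateGrowth).pow _).mul ih
  exact h _

/-- The Schwartz function `x^α ∂^β φ`. -/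
def weighted {d : ℕ} (α β : Fin d → ℕ) : 𝓢(E d, ℝ) →L[ℝ] 𝓢(E d, ℝ) :=
  (smulLeftCLM ℝ (monomial α)).comp (mderiv β)

theorem weighted_apply {d : ℕ} (α β : Fin d → ℕ) (φ : 𝓢(E d, ℝ)) (x : E d) :
    weighted α β φ x = monomial α x * mderiv β φ x := by
  simp [weighted, smulLeftCLM_apply_apply (monomial_hasTemperateGrowth α)]

/-- The `L²` pairing of two Schwartz functions. -/
theorem inner_toLp {d : ℕ} (φ ψ : 𝓢(E d, ℝ)) :
    inner ℝ (φ.toLp 2) (ψ.toLp 2) = ∫ x, φ x * ψ x := by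
  rw [L2.inner_def]
  refine integral_congr_ae ?_
  filter_upwards [φ.coeFn_toLp 2, ψ.coeFn_toLp 2] with x hx hy
  simp [hx, hy, mul_comm]

theorem schwartzInner_eq {d : ℕ} (p : ℕ) (φ ψ : 𝓢(E d, ℝ)) :
    schwartzInner p φ ψ = ∑ ab ∈ indexSet d p,
      inner ℝ (toLpCLM ℝ ℝ 2 volume (weighted ab.1 ab.2 φ))
        (toLpCLM ℝ ℝ 2 volume (weighted ab.1 ab.2 ψ)) := by
  refine Finset.sum_congr rfl fun ab _ => ?_
  change _ = inner ℝ ((weighted ab.1 ab.2 φ).toLp 2) ((weighted ab.1 ab.2 ψ).toLp 2)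
  rw [inner_toLp]
  simp only [weighted_apply]

theorem schwartzInner_mono {d p q : ℕ} (h : q ≤ p) (φ : 𝓢(E d, ℝ)) :
    schwartzInner q φ φ ≤ schwartzInner p φ φ := by
  rw [schwartzInner_eq, schwartzInner_eq]
  exact Finset.sum_le_sum_of_subset_of_nonneg (indexSet_mono h)
    fun _ _ _ => real_inner_self_nonneg

theorem weighted_zero {d : ℕ} (φ : 𝓢(E d, ℝ)) : weighted 0 0 φ = φ := by
  ext x
  simp [weighted_apply, monomial, mderiv_zero]

theorem norm_toLp_sq_le {d : ℕ} (p : ℕ) (φ : 𝓢(E d, ℝ)) :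
    ‖toLpCLM ℝ ℝ 2 volume φ‖ ^ 2 ≤ schwartzInner p φ φ := by
  have h : ∀ F : (Fin d → ℕ) × (Fin d → ℕ) → ℝ, (∀ ab, 0 ≤ F ab) →
      F (0, 0) ≤ ∑ ab ∈ indexSet d p, F ab := fun F hF =>
    Finset.single_le_sum (fun ab _ => hF ab) ((mem_indexSet 0 0).2 (by simp))
  rw [schwartzInner_eq, ← real_inner_self_eq_norm_sq]
  refine le_trans (le_of_eq ?_) (h _ fun ab => real_inner_self_nonneg)
  rw [weighted_zero]

/-- The space `𝓢(ℝᵈ)`, to be equipped with the norm `‖·‖_p` in place of its usual topology. -/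
def PreS (d _p : ℕ) : Type := 𝓢(E d, ℝ)

instance (d p : ℕ) : AddCommGroup (PreS d p) := inferInstanceAs (AddCommGroup 𝓢(E d, ℝ))
instance (d p : ℕ) : Module ℝ (PreS d p) := inferInstanceAs (Module ℝ 𝓢(E d, ℝ))

/-- A Schwartz function, seen in `(𝓢(ℝᵈ), ‖·‖_p)`. -/
def toPre {d : ℕ} (p : ℕ) : 𝓢(E d, ℝ) ≃ₗ[ℝ] PreS d p := LinearEquiv.refl ℝ _

/-- The laws of an inner product for `⟨·,·⟩_p` on `𝓢(ℝᵈ)`. -/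
@[reducible]
def schwartzInnerCore (d p : ℕ) : InnerProductSpace.Core ℝ (PreS d p) where
  inner φ ψ := schwartzInner p ((toPre p).symm φ) ((toPre p).symm ψ)
  conj_inner_symm φ ψ := by
    simp only [schwartzInner, conj_trivial]
    exact Finset.sum_congr rfl fun _ _ => integral_congr_ae (.of_forall fun _ => mul_comm _ _)
  re_inner_nonneg φ := by
    simp only [schwartzInner_eq, RCLike.re_to_real]
    exact Finset.sum_nonneg fun _ _ => real_inner_self_nonneg
  add_left φ ψ χ := by
    simp only [schwartzInner_eq, map_add, inner_add_left, Finset.sum_add_distrib]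
  smul_left φ ψ r := by
    simp only [schwartzInner_eq, map_smul, inner_smul_left, Finset.mul_sum]
  definite φ h := by
    have h1 := norm_toLp_sq_le p ((toPre p).symm φ)
    rw [h] at h1
    have h2 : toLpCLM ℝ ℝ 2 volume ((toPre p).symm φ) = 0 := by
      rw [← norm_eq_zero]
      exact pow_eq_zero_iff (two_ne_zero) |>.1 (le_antisymm h1 (sq_nonneg _))
    have h3 : (toPre p).symm φ = 0 :=
      SchwartzMap.injective_toLp (F := ℝ) 2 (volume : Measure (E d))
        (h2.trans (map_zero (toLpCLM ℝ ℝ 2 volume)).symm)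
    exact (toPre p).symm.map_eq_zero_iff.1 h3

instance (d p : ℕ) : NormedAddCommGroup (PreS d p) :=
  (schwartzInnerCore d p).toNormedAddCommGroup
instance (d p : ℕ) : InnerProductSpace ℝ (PreS d p) :=
  InnerProductSpace.ofCore (schwartzInnerCore d p).toCore

theorem inner_toPre {d : ℕ} (p : ℕ) (φ ψ : 𝓢(E d, ℝ)) :
    inner ℝ (toPre p φ) (toPre p ψ) = schwartzInner p φ ψ := rfl

theorem norm_toPre_sq {d : ℕ} (p : ℕ) (φ : 𝓢(E d, ℝ)) :
    ‖toPre p φ‖ ^ 2 = schwartzInner p φ φ := by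
  rw [← real_inner_self_eq_norm_sq, inner_toPre]

/-! ### The Hermite–Sobolev spaces `𝓢_p(ℝᵈ)` -/

/-- The Hermite–Sobolev space `𝓢_p(ℝᵈ)`: the completion of `𝓢(ℝᵈ)` in the norm `‖·‖_p`,
a real Hilbert space with the extended inner product `⟨·,·⟩_p`. -/
abbrev SSpace (d p : ℕ) : Type := UniformSpace.Completion (PreS d p)

/-- A Schwartz function as an element of `𝓢_p(ℝᵈ)`. -/
def ofSchwartz {d : ℕ} (p : ℕ) (φ : 𝓢(E d, ℝ)) : SSpace d p := (toPre p φ : PreS d p)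

theorem inner_ofSchwartz {d : ℕ} (p : ℕ) (φ ψ : 𝓢(E d, ℝ)) :
    inner ℝ (ofSchwartz p φ) (ofSchwartz p ψ) = schwartzInner p φ ψ := by
  rw [ofSchwartz, ofSchwartz, UniformSpace.Completion.inner_coe, inner_toPre]

theorem denseRange_ofSchwartz (d p : ℕ) :
    DenseRange (ofSchwartz p : 𝓢(E d, ℝ) → SSpace d p) :=
  UniformSpace.Completion.denseRange_coe.comp (toPre p).surjective.denseRange
    (UniformSpace.Completion.continuous_coe _)

/-- The identity `(𝓢(ℝᵈ), ‖·‖_p) → 𝓢_q(ℝᵈ)` for `q ≤ p`. -/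
def preInclusion (d : ℕ) {p q : ℕ} (h : q ≤ p) : PreS d p →L[ℝ] SSpace d q :=
  LinearMap.mkContinuous
    ((UniformSpace.Completion.toComplL : PreS d q →L[ℝ] SSpace d q).toLinearMap ∘ₗ
      (toPre q).toLinearMap ∘ₗ (toPre p).symm.toLinearMap) 1 (by
    intro φ
    obtain ⟨φ, rfl⟩ := (toPre p).surjective φ
    simp only [LinearMap.comp_apply, LinearEquiv.coe_coe, LinearEquiv.symm_apply_apply, one_mul,
      ContinuousLinearMap.coe_coe, UniformSpace.Completion.coe_toComplL,
      UniformSpace.Completion.norm_coe]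
    rw [← sq_le_sq₀ (norm_nonneg _) (norm_nonneg _), norm_toPre_sq, norm_toPre_sq]
    exact schwartzInner_mono h φ)

/-- The continuous inclusion `𝓢_p(ℝᵈ) ⊂ 𝓢_q(ℝᵈ)` for `q ≤ p`, extending the identity of
`𝓢(ℝᵈ)`. -/
def inclusion (d : ℕ) {p q : ℕ} (h : q ≤ p) : SSpace d p →L[ℝ] SSpace d q :=
  (preInclusion d h).extend (UniformSpace.Completion.toComplL : PreS d p →L[ℝ] SSpace d p)

theorem inclusion_ofSchwartz {d p q : ℕ} (h : q ≤ p) (φ : 𝓢(E d, ℝ)) :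
    inclusion d h (ofSchwartz p φ) = ofSchwartz q φ :=
  ContinuousLinearMap.extend_eq _ UniformSpace.Completion.denseRange_coe
    (UniformSpace.Completion.isUniformInducing_coe _) (toPre p φ)

/-! ### Tempered distributions and the embedding `𝓢_p(ℝᵈ) ⊂ 𝓢'(ℝᵈ)` -/

/-- The (real) tempered distributions `𝓢'(ℝᵈ)`. -/
abbrev TD (d : ℕ) : Type := 𝓢(E d, ℝ) →L[ℝ] ℝ

/-- The map `(𝓢(ℝᵈ), ‖·‖_p) → L²(ℝᵈ)`. -/
def preToL2 (d p : ℕ) : PreS d p →L[ℝ] Lp ℝ 2 (volume : Measure (E d)) :=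
  LinearMap.mkContinuous
    ((toLpCLM ℝ ℝ 2 volume).toLinearMap ∘ₗ (toPre p).symm.toLinearMap) 1 (by
    intro φ
    obtain ⟨φ, rfl⟩ := (toPre p).surjective φ
    simp only [LinearMap.comp_apply, LinearEquiv.coe_coe, LinearEquiv.symm_apply_apply, one_mul,
      ContinuousLinearMap.coe_coe]
    rw [← sq_le_sq₀ (norm_nonneg _) (norm_nonneg _), norm_toPre_sq]
    exact norm_toLp_sq_le p φ)

/-- The continuous inclusion `𝓢_p(ℝᵈ) ⊂ L²(ℝᵈ)`, extending the one of `𝓢(ℝᵈ)`. -/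
def toL2 (d p : ℕ) : SSpace d p →L[ℝ] Lp ℝ 2 (volume : Measure (E d)) :=
  (preToL2 d p).extend (UniformSpace.Completion.toComplL : PreS d p →L[ℝ] SSpace d p)

theorem toL2_ofSchwartz {d p : ℕ} (φ : 𝓢(E d, ℝ)) : toL2 d p (ofSchwartz p φ) = φ.toLp 2 :=
  ContinuousLinearMap.extend_eq _ UniformSpace.Completion.denseRange_coe
    (UniformSpace.Completion.isUniformInducing_coe _) (toPre p φ)

/-- The element of `𝓢'(ℝᵈ)` given by an element of `𝓢_p(ℝᵈ)`: `ψ ↦ ∫ φ ψ dx`. -/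
def toTD {d p : ℕ} (φ : SSpace d p) : TD d :=
  (innerSL ℝ (toL2 d p φ)).comp (toLpCLM ℝ ℝ 2 volume)

theorem toTD_apply {d p : ℕ} (φ : SSpace d p) (ψ : 𝓢(E d, ℝ)) :
    toTD φ ψ = inner ℝ (toL2 d p φ) (ψ.toLp 2) := rfl

theorem toTD_ofSchwartz {d p : ℕ} (φ ψ : 𝓢(E d, ℝ)) :
    toTD (ofSchwartz p φ) ψ = ∫ x, φ x * ψ x := by
  rw [toTD_apply, toL2_ofSchwartz, inner_toLp]

/-- The inclusion `𝓢_p(ℝᵈ) ⊂ 𝓢_q(ℝᵈ)` is compatible with the embeddings in `𝓢'(ℝᵈ)`. -/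
theorem toTD_inclusion {d p q : ℕ} (h : q ≤ p) (φ : SSpace d p) :
    toTD (inclusion d h φ) = toTD φ := by
  have : toL2 d q (inclusion d h φ) = toL2 d p φ := by
    refine (denseRange_ofSchwartz d p).induction_on φ
      (isClosed_eq (by fun_prop) (by fun_prop)) fun φ => ?_
    rw [inclusion_ofSchwartz, toL2_ofSchwartz, toL2_ofSchwartz]
  simp only [toTD, this]

theorem adjoint_pderiv {d : ℕ} (j : Fin d) (φ ψ : 𝓢(E d, ℝ)) :
    ∫ x, pderiv j φ x * ψ x = ∫ x, φ x * (-pderiv j ψ) x := by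
  have := integral_mul_lineDerivOp_right_eq_neg_left (μ := volume) φ ψ (EuclideanSpace.single j 1)
  simp only [neg_apply, mul_neg, integral_neg]
  rw [eq_neg_iff_add_eq_zero, add_comm, ← eq_neg_iff_add_eq_zero]
  exact this

theorem exists_adjoint_mderiv {d : ℕ} (β : Fin d → ℕ) (ψ : 𝓢(E d, ℝ)) :
    ∃ χ : 𝓢(E d, ℝ), ∀ φ : 𝓢(E d, ℝ), ∫ x, mderiv β φ x * ψ x = ∫ x, φ x * χ x := by
  have hp : ∀ (j : Fin d) (n : ℕ) (ψ : 𝓢(E d, ℝ)), ∃ χ : 𝓢(E d, ℝ),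
      ∀ φ : 𝓢(E d, ℝ), ∫ x, (pderiv j ^ n) φ x * ψ x = ∫ x, φ x * χ x := by
    intro j n
    induction n with
    | zero => exact fun ψ => ⟨ψ, fun φ => rfl⟩
    | succ n ih =>
      intro ψ
      obtain ⟨χ, hχ⟩ := ih (-pderiv j ψ)
      refine ⟨χ, fun φ => ?_⟩
      rw [pow_succ', mul_apply_eq_comp, adjoint_pderiv, hχ]
  have hl : ∀ (l : List (Fin d)) (ψ : 𝓢(E d, ℝ)), ∃ χ : 𝓢(E d, ℝ), ∀ φ : 𝓢(E d, ℝ),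
      ∫ x, (l.map fun j => pderiv j ^ β j).prod φ x * ψ x = ∫ x, φ x * χ x := by
    intro l
    induction l with
    | nil => exact fun ψ => ⟨ψ, fun φ => rfl⟩
    | cons a l ih =>
      intro ψ
      obtain ⟨χ, hχ⟩ := hp a (β a) ψ
      obtain ⟨χ', hχ'⟩ := ih χ
      refine ⟨χ', fun φ => ?_⟩
      rw [List.map_cons, List.prod_cons, mul_apply_eq_comp, hχ, hχ']
  exact hl _ ψ

theorem exists_adjoint {d : ℕ} (p : ℕ) (ψ : 𝓢(E d, ℝ)) :
    ∃ χ : 𝓢(E d, ℝ), ∀ φ : 𝓢(E d, ℝ), schwartzInner p φ ψ = ∫ x, φ x * χ x := by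
  have h : ∀ ab : (Fin d → ℕ) × (Fin d → ℕ), ∃ χ : 𝓢(E d, ℝ), ∀ φ : 𝓢(E d, ℝ),
      ∫ x, (monomial ab.1 x * mderiv ab.2 φ x) * (monomial ab.1 x * mderiv ab.2 ψ x)
        = ∫ x, φ x * χ x := by
    rintro ⟨α, β⟩
    obtain ⟨χ, hχ⟩ := exists_adjoint_mderiv β
      (smulLeftCLM ℝ (monomial α) (weighted α β ψ))
    refine ⟨χ, fun φ => ?_⟩
    rw [← hχ]
    refine integral_congr_ae (.of_forall fun x => ?_)
    simp only [smulLeftCLM_apply_apply (monomial_hasTemperateGrowth α), weighted_apply,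
      smul_eq_mul]
    ring
  choose χ hχ using h
  refine ⟨∑ ab ∈ indexSet d p, χ ab, fun φ => ?_⟩
  simp only [← inner_toLp, schwartzInner] at hχ ⊢
  have : (∑ ab ∈ indexSet d p, χ ab).toLp 2 = ∑ ab ∈ indexSet d p, (χ ab).toLp 2 (volume) :=
    map_sum (toLpCLM ℝ ℝ 2 (volume : Measure (E d))) _ _
  rw [this, inner_sum]
  exact Finset.sum_congr rfl fun ab _ => hχ ab φ

/-- Elements of `𝓢_p(ℝᵈ)` are determined by the tempered distributions that they define. -/
theorem toTD_injective (d p : ℕ) : Function.Injective (toTD : SSpace d p → TD d) := by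
  have key : ∀ ψ : 𝓢(E d, ℝ), ∃ χ : 𝓢(E d, ℝ), ∀ φ : SSpace d p,
      inner ℝ φ (ofSchwartz p ψ) = toTD φ χ := by
    intro ψ
    obtain ⟨χ, hχ⟩ := exists_adjoint p ψ
    refine ⟨χ, fun φ => ?_⟩
    simp only [toTD_apply]
    refine (denseRange_ofSchwartz d p).induction_on φ
      (isClosed_eq (by fun_prop) (by fun_prop)) fun φ => ?_
    rw [inner_ofSchwartz, toL2_ofSchwartz, inner_toLp, hχ]
  intro φ₁ φ₂ h
  refine (denseRange_ofSchwartz d p).eq_of_inner_left ℝ ?_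
  intro v
  obtain ⟨χ, hχ⟩ := key v
  rw [hχ, hχ, h]

/-! ### The operators `L` and `A_i` on `𝓢'(ℝᵈ)` -/

/-- The derivative of a tempered distribution, `⟨∂ⱼ T, ψ⟩ = -⟨T, ∂ⱼ ψ⟩`. -/
def tdDeriv {d : ℕ} (j : Fin d) (T : TD d) : TD d := -(T.comp (pderiv j))

/-- The product of a tempered distribution with a function `a`, `⟨a T, ψ⟩ = ⟨T, a ψ⟩`
(meaningful for `a` of temperate growth). -/
def tdMul {d : ℕ} (a : E d → ℝ) (T : TD d) : TD d := T.comp (smulLeftCLM ℝ a)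

/-- `A_i T = ∑ⱼ σ_{ji} ∂ⱼ T + h_i T`. -/
def opA {d : ℕ} (σ : E d → Matrix (Fin d) (Fin d) ℝ) (h : Fin d → E d → ℝ) (i : Fin d)
    (T : TD d) : TD d :=
  ∑ j, tdMul (fun x => σ x j i) (tdDeriv j T) + tdMul (h i) T

/-- `L T = ½ ∑_{i,j} (σ σᵗ)_{ij} ∂²_{ij} T + ∑ⱼ f_j ∂ⱼ T + g T`. -/
def opL {d : ℕ} (σ : E d → Matrix (Fin d) (Fin d) ℝ) (f : Fin d → E d → ℝ) (g : E d → ℝ)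
    (T : TD d) : TD d :=
  (1 / 2 : ℝ) • ∑ i, ∑ j, tdMul (fun x => (σ x * (σ x).transpose) i j) (tdDeriv i (tdDeriv j T))
    + ∑ j, tdMul (f j) (tdDeriv j T) + tdMul g T

/-- `a : ℝᵈ → ℝ` is smooth and all its derivatives of order `≥ 1` are bounded. -/
def HasBoundedDerivs {d : ℕ} (a : E d → ℝ) : Prop :=
  ContDiff ℝ ∞ a ∧ ∀ n : ℕ, 1 ≤ n → ∃ M : ℝ, ∀ x, ‖iteratedFDeriv ℝ n a x‖ ≤ M

/-- `a : ℝᵈ → ℝ` is bounded. -/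
def IsBoundedFun {d : ℕ} (a : E d → ℝ) : Prop := ∃ M : ℝ, ∀ x, |a x| ≤ M

/-- Products `a T` with smooth `a` having bounded derivatives are genuine. -/
theorem HasBoundedDerivs.hasTemperateGrowth {d : ℕ} {a : E d → ℝ} (ha : HasBoundedDerivs a) :
    a.HasTemperateGrowth := by
  have hd : Differentiable ℝ a := ha.1.differentiable (by simp)
  obtain ⟨M, hM⟩ := ha.2 1 le_rfl
  have hM' : ∀ x, ‖fderiv ℝ a x‖ ≤ M := fun x => by
    simpa only [norm_iteratedFDeriv_one] using hM x
  have hM0 : 0 ≤ M := (norm_nonneg _).trans (hM' 0)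
  refine ⟨ha.1, fun n => ?_⟩
  rcases n with _ | n
  · refine ⟨1, |a 0| + M, fun x => ?_⟩
    have h1 := Convex.norm_image_sub_le_of_norm_fderiv_le (fun y _ => hd y) (fun y _ => hM' y)
      convex_univ (Set.mem_univ 0) (Set.mem_univ x)
    rw [sub_zero, Real.norm_eq_abs] at h1
    rw [norm_iteratedFDeriv_zero, Real.norm_eq_abs, pow_one]
    have h2 : |a x| ≤ |a x - a 0| + |a 0| := by simpa using abs_add_le (a x - a 0) (a 0)
    nlinarith [norm_nonneg x, abs_nonneg (a 0), mul_nonneg (abs_nonneg (a 0)) (norm_nonneg x)]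
  · obtain ⟨K, hK⟩ := ha.2 (n + 1) (by omega)
    exact ⟨0, K, fun x => by simpa using hK x⟩

theorem tdDeriv_ofSchwartz {d p : ℕ} (j : Fin d) (φ : 𝓢(E d, ℝ)) :
    tdDeriv j (toTD (ofSchwartz p φ)) = toTD (ofSchwartz p (pderiv j φ)) := by
  ext ψ
  rw [toTD_ofSchwartz, adjoint_pderiv, ← toTD_ofSchwartz (p := p), map_neg]
  rfl

theorem tdMul_ofSchwartz {d p : ℕ} {a : E d → ℝ} (ha : a.HasTemperateGrowth) (φ : 𝓢(E d, ℝ)) :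
    tdMul a (toTD (ofSchwartz p φ)) = toTD (ofSchwartz p (smulLeftCLM ℝ a φ)) := by
  ext ψ
  change toTD (ofSchwartz p φ) (smulLeftCLM ℝ a ψ) = _
  rw [toTD_ofSchwartz, toTD_ofSchwartz]
  refine integral_congr_ae (.of_forall fun x => ?_)
  simp only [smulLeftCLM_apply_apply ha, smul_eq_mul]
  ring

end HermiteSobolev

end

/-! Every estimate is made on Schwartz functions; density and continuity then give the result on
`𝓢_p`. Multiplication by a function with bounded derivatives (such as `x_j` or `f_j`) and each `∂_j`
count as order one, and multiplication by a bounded smooth function as order zero (`IsOp`). An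
operator of order `k` loses `k` units in the scale of word norms (`IsOp.wordNorm_le`), and the word
norm of index `2 p` is controlled by `‖·‖_p` (`wordNorm_le_norm_toPre`). Hence operators of order `2
q` are bounded from `‖·‖_q` to `L²`, and `L`, of order 2, is bounded from `𝓢_p` to `𝓢_q` as soon as
`q + 1 ≤ p`.

The inequality itself loses nothing, because of a cancellation. Completing squares gives `2 L = ∑ᵢ
A_i² + 2 B` with `B` of first order in the derivatives (`exists_two_smul_schwartzL_eq`). Integration
by parts shows that a first order `A` satisfies `A* = -A + c` with `c` bounded
(`l2Inner_firstOrder`).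

Fix `D = x^α ∂^β` of order at most `2 q`. Commutators with `A` do not raise the order, so `R = [D,
A]` and `R' = [R, A]` are again of order `2 q`. In `⟨Dφ, D A² φ⟩ + ‖D A φ‖²` the terms of higher
order cancel, leaving pairings of operators of order `2 q`, which Cauchy–Schwarz bounds by `‖φ‖_q²`
(`isQuadBounded_firstOrder_sq`). In `2 ⟨Dφ, D B φ⟩` the antisymmetric part of `B` drops out, and
`[D, B]` keeps the order of `D` although the coefficients of `B` may grow linearly
(`isQuadBounded_firstOrder`). Summing over `D` and over `i` gives the claim. -/

noncomputable section

namespace HermiteSobolev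

open MeasureTheory SchwartzMap LineDeriv
open scoped ContDiff

section

/-! ### Coefficient functions -/

/-- Smooth functions that are bounded together with all their derivatives. -/
def IsBddSmooth {d : ℕ} (a : E d → ℝ) : Prop :=
  ContDiff ℝ ∞ a ∧ ∀ n : ℕ, ∃ M : ℝ, ∀ x, ‖iteratedFDeriv ℝ n a x‖ ≤ M

/-- The partial derivative of a function. -/
def partialDeriv {d : ℕ} (j : Fin d) (a : E d → ℝ) (x : E d) : ℝ :=
  fderiv ℝ a x (EuclideanSpace.single j 1)

variable {d : ℕ} {a b : E d → ℝ}

theorem isBddSmooth_iff : IsBddSmooth a ↔ IsBoundedFun a ∧ HasBoundedDerivs a := by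
  constructor
  · rintro ⟨h, h'⟩
    refine ⟨?_, h, fun n _ => h' n⟩
    obtain ⟨M, hM⟩ := h' 0
    exact ⟨M, fun x => by simpa using hM x⟩
  · rintro ⟨⟨M, hM⟩, h, h'⟩
    refine ⟨h, fun n => ?_⟩
    rcases n with _ | n
    · exact ⟨M, fun x => by simpa using hM x⟩
    · exact h' _ (by omega)

theorem IsBddSmooth.bounded (h : IsBddSmooth a) : ∃ M : ℝ, 0 ≤ M ∧ ∀ x, |a x| ≤ M := by
  obtain ⟨M, hM⟩ := (isBddSmooth_iff.1 h).1
  exact ⟨M, (abs_nonneg _).trans (hM 0), hM⟩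

theorem IsBddSmooth.hasBoundedDerivs (h : IsBddSmooth a) : HasBoundedDerivs a :=
  (isBddSmooth_iff.1 h).2

theorem IsBddSmooth.hasTemperateGrowth (h : IsBddSmooth a) : a.HasTemperateGrowth :=
  h.hasBoundedDerivs.hasTemperateGrowth

theorem isBddSmooth_const (c : ℝ) : IsBddSmooth (fun _ : E d => c) := by
  refine ⟨contDiff_const, fun n => ⟨|c|, fun x => ?_⟩⟩
  rcases n with _ | n
  · simp
  · simp [iteratedFDeriv_const_of_ne (n := n + 1) (by simp)]

theorem IsBddSmooth.add (ha : IsBddSmooth a) (hb : IsBddSmooth b) :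
    IsBddSmooth (fun x => a x + b x) := by
  refine ⟨ha.1.add hb.1, fun n => ?_⟩
  obtain ⟨M, hM⟩ := ha.2 n
  obtain ⟨N, hN⟩ := hb.2 n
  refine ⟨M + N, fun x => ?_⟩
  have h := iteratedFDeriv_add_apply (𝕜 := ℝ) (i := n) (x := x) (f := a) (g := b)
    ((ha.1.of_le (by exact_mod_cast le_top)).contDiffAt)
    ((hb.1.of_le (by exact_mod_cast le_top)).contDiffAt)
  exact (le_of_eq (congrArg norm h)).trans ((norm_add_le _ _).trans (add_le_add (hM x) (hN x)))

theorem HasBoundedDerivs.add (ha : HasBoundedDerivs a) (hb : HasBoundedDerivs b) :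
    HasBoundedDerivs (fun x => a x + b x) := by
  refine ⟨ha.1.add hb.1, fun n hn => ?_⟩
  obtain ⟨M, hM⟩ := ha.2 n hn
  obtain ⟨N, hN⟩ := hb.2 n hn
  refine ⟨M + N, fun x => ?_⟩
  have h := iteratedFDeriv_add_apply (𝕜 := ℝ) (i := n) (x := x) (f := a) (g := b)
    ((ha.1.of_le (by exact_mod_cast le_top)).contDiffAt)
    ((hb.1.of_le (by exact_mod_cast le_top)).contDiffAt)
  exact (le_of_eq (congrArg norm h)).trans ((norm_add_le _ _).trans (add_le_add (hM x) (hN x)))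

theorem IsBddSmooth.mul (ha : IsBddSmooth a) (hb : IsBddSmooth b) :
    IsBddSmooth (fun x => a x * b x) := by
  refine ⟨ha.1.mul hb.1, fun n => ?_⟩
  choose M hM using ha.2
  choose N hN using hb.2
  refine ⟨∑ i ∈ Finset.range (n + 1), (n.choose i : ℝ) * M i * N (n - i), fun x => ?_⟩
  refine (norm_iteratedFDeriv_mul_le ha.1 hb.1 x (by exact_mod_cast le_top)).trans ?_
  gcongr with i _
  · exact mul_nonneg (Nat.cast_nonneg _) ((norm_nonneg _).trans (hM i x))
  · exact hM i x
  · exact hN _ x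

theorem IsBddSmooth.const_mul (c : ℝ) (ha : IsBddSmooth a) : IsBddSmooth (fun x => c * a x) :=
  (isBddSmooth_const c).mul ha

theorem IsBddSmooth.neg (ha : IsBddSmooth a) : IsBddSmooth (fun x => -a x) := by
  simpa using ha.const_mul (-1)

theorem IsBddSmooth.sum {ι : Type*} {s : Finset ι} {a : ι → E d → ℝ}
    (h : ∀ i ∈ s, IsBddSmooth (a i)) : IsBddSmooth (fun x => ∑ i ∈ s, a i x) := by
  classical
  induction s using Finset.induction_on with
  | empty => simpa using isBddSmooth_const (d := d) 0
  | insert i s hi ih =>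
    simp only [Finset.sum_insert hi]
    exact (h i (Finset.mem_insert_self i s)).add
      (ih fun k hk => h k (Finset.mem_insert_of_mem hk))

/-- One derivative is enough to bring a coefficient of linear growth into the bounded class; this is
why commutators involving `f_j` remain under control. -/
theorem HasBoundedDerivs.partialDeriv (ha : HasBoundedDerivs a) (j : Fin d) :
    IsBddSmooth (partialDeriv j a) := by
  have h : ContDiff ℝ ∞ (fderiv ℝ a) := ha.1.fderiv_right (by simp)
  refine ⟨h.clm_apply contDiff_const, fun n => ?_⟩
  obtain ⟨M, hM⟩ := ha.2 (n + 1) (by omega)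
  refine ⟨M, fun x => ?_⟩
  refine (norm_iteratedFDeriv_clm_apply_const (𝕜 := ℝ) (n := n)
    (c := EuclideanSpace.single j (1 : ℝ)) h.contDiffAt (by exact_mod_cast le_top)).trans ?_
  simpa [norm_iteratedFDeriv_fderiv] using hM x

theorem IsBddSmooth.partialDeriv (ha : IsBddSmooth a) (j : Fin d) :
    IsBddSmooth (partialDeriv j a) :=
  ha.hasBoundedDerivs.partialDeriv j

theorem partialDeriv_coord (i j : Fin d) (x : E d) :
    partialDeriv j (fun x : E d => x i) x = if i = j then 1 else 0 := by
  have : (fun x : E d => x i) = (EuclideanSpace.proj i : E d →L[ℝ] ℝ) := rfl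
  rw [HermiteSobolev.partialDeriv, this, ContinuousLinearMap.fderiv]
  simp

/-- Puts the weights `x_i` and the drift coefficients `f_j` in the same class, so that both are
handled by the same commutation rules. -/
theorem hasBoundedDerivs_coord (i : Fin d) : HasBoundedDerivs (fun x : E d => x i) := by
  have hs : ContDiff ℝ ∞ (EuclideanSpace.proj i : E d →L[ℝ] ℝ) := ContinuousLinearMap.contDiff _
  refine ⟨hs, fun n hn => ?_⟩
  obtain ⟨n, rfl⟩ := Nat.exists_eq_add_of_le' hn
  have : fderiv ℝ (fun x : E d => x i) = fun _ => (EuclideanSpace.proj i : E d →L[ℝ] ℝ) :=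
    funext fun x => (EuclideanSpace.proj i : E d →L[ℝ] ℝ).fderiv
  refine ⟨‖(EuclideanSpace.proj i : E d →L[ℝ] ℝ)‖, fun x => ?_⟩
  rw [← norm_iteratedFDeriv_fderiv, this]
  rcases n with _ | n
  · simp
  · simp [iteratedFDeriv_const_of_ne (n := n + 1) (by simp)]

/-! ### Multiplication and differentiation operators -/

/-- Continuous linear operators on `𝓢(ℝᵈ)`. -/
abbrev Op (d : ℕ) : Type := 𝓢(E d, ℝ) →L[ℝ] 𝓢(E d, ℝ)

/-- Multiplication by a function (of temperate growth). -/
def mulOp (a : E d → ℝ) : Op d := smulLeftCLM ℝ a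

theorem mulOp_apply (ha : a.HasTemperateGrowth) (φ : 𝓢(E d, ℝ)) (x : E d) :
    mulOp a φ x = a x * φ x := by
  simp [mulOp, smulLeftCLM_apply_apply ha]

theorem mulOp_mul (ha : a.HasTemperateGrowth) (hb : b.HasTemperateGrowth) :
    mulOp a * mulOp b = mulOp (fun x => a x * b x) := by
  ext φ x
  have : (fun x => a x * b x).HasTemperateGrowth := ha.mul hb
  simp only [mul_apply_eq_comp, mulOp_apply ha, mulOp_apply hb, mulOp_apply this]
  ring

theorem mulOp_add (ha : a.HasTemperateGrowth) (hb : b.HasTemperateGrowth) :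
    mulOp (fun x => a x + b x) = mulOp a + mulOp b := smulLeftCLM_add ha hb

theorem mulOp_neg (ha : a.HasTemperateGrowth) : mulOp (fun x => -a x) = -mulOp a :=
  smulLeftCLM_neg ha

theorem mulOp_const_mul (c : ℝ) (ha : a.HasTemperateGrowth) :
    mulOp (fun x => c * a x) = c • mulOp a := smulLeftCLM_smul ha c

theorem mulOp_const (c : ℝ) : mulOp (fun _ : E d => c) = c • (1 : Op d) := smulLeftCLM_const c

theorem mulOp_sum {ι : Type*} {s : Finset ι} {a : ι → E d → ℝ}
    (h : ∀ i ∈ s, (a i).HasTemperateGrowth) :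
    mulOp (fun x => ∑ i ∈ s, a i x) = ∑ i ∈ s, mulOp (a i) := smulLeftCLM_sum h

theorem mulOp_comm (ha : a.HasTemperateGrowth) (hb : b.HasTemperateGrowth) :
    mulOp a * mulOp b = mulOp b * mulOp a := by
  rw [mulOp_mul ha hb, mulOp_mul hb ha]
  simp only [mul_comm]

/-- The Leibniz rule. Temperate growth is the right generality because the rule is also applied to
monomials, whose derivatives are not bounded. -/
theorem pderiv_mulOp_of_hasTemperateGrowth {j : Fin d} (hd : Differentiable ℝ a)
    (h1 : a.HasTemperateGrowth) (h2 : (partialDeriv j a).HasTemperateGrowth) :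
    pderiv j * mulOp a = mulOp a * pderiv j + mulOp (partialDeriv j a) := by
  ext φ x
  have h3 : (mulOp a φ : E d → ℝ) = a * φ := funext fun x => mulOp_apply h1 φ x
  simp only [mul_apply_eq_comp, add_apply, mulOp_apply h1, mulOp_apply h2, pderiv_apply, h3]
  rw [fderiv_mul (hd x) φ.differentiableAt]
  simp [partialDeriv]
  ring

theorem pderiv_mulOp (ha : HasBoundedDerivs a) (j : Fin d) :
    pderiv j * mulOp a = mulOp a * pderiv j + mulOp (partialDeriv j a) :=
  pderiv_mulOp_of_hasTemperateGrowth (ha.1.differentiable (by simp)) ha.hasTemperateGrowth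
    (ha.partialDeriv j).hasTemperateGrowth

theorem pderiv_comm (i j : Fin d) : pderiv i * pderiv j = (pderiv j * pderiv i : Op d) := by
  have key : ∀ (i j : Fin d) (φ : 𝓢(E d, ℝ)) (x : E d), pderiv i (pderiv j φ) x
      = fderiv ℝ (fderiv ℝ φ) x (EuclideanSpace.single i 1) (EuclideanSpace.single j 1) := by
    intro i j φ x
    have h : (pderiv j φ : E d → ℝ) = fun y => fderiv ℝ φ y (EuclideanSpace.single j 1) := rfl
    have hd : DifferentiableAt ℝ (fderiv ℝ φ) x :=
      ((φ.smooth ⊤).fderiv_right (m := ∞) (by simp)).differentiable (by simp) x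
    rw [pderiv_apply, h, fderiv_clm_apply hd (differentiableAt_const _)]
    simp
  ext φ x
  simp only [mul_apply_eq_comp, key]
  exact ((φ.smooth 2).contDiffAt.isSymmSndFDerivAt (by simp)) _ _

end

section

/-! ### Differential operators with polynomial weights -/

/-- Multiplication by the coordinate `x_j`. -/
def coordOp {d : ℕ} (j : Fin d) : Op d := mulOp fun x => x j

/-- The differential operators of order at most `k`, where the functions with bounded derivatives
of order `≥ 1` and the partial derivatives both count as being of order one. -/
inductive IsOp {d : ℕ} : ℕ → Op d → Prop
  | mul_bdd {a : E d → ℝ} (ha : IsBddSmooth a) : IsOp 0 (mulOp a)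
  | mul {a : E d → ℝ} (ha : HasBoundedDerivs a) : IsOp 1 (mulOp a)
  | deriv (j : Fin d) : IsOp 1 (pderiv j)
  | comp {k l : ℕ} {S T : Op d} : IsOp k S → IsOp l T → IsOp (k + l) (S * T)
  | add {k : ℕ} {S T : Op d} : IsOp k S → IsOp k T → IsOp k (S + T)
  | mono {k l : ℕ} {S : Op d} : k ≤ l → IsOp k S → IsOp l S

variable {d : ℕ} {a : E d → ℝ} {k l : ℕ} {S T : Op d}

theorem IsOp.smul (c : ℝ) (h : IsOp k T) : IsOp k (c • T) := by
  have := IsOp.comp (IsOp.mul_bdd (isBddSmooth_const c)) h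
  rw [zero_add, mulOp_const, smul_mul_assoc, one_mul] at this
  exact this

theorem IsOp.one : IsOp (d := d) 0 1 := by
  simpa [mulOp_const] using IsOp.mul_bdd (isBddSmooth_const (d := d) 1)

theorem IsOp.zero : IsOp (d := d) k 0 := by
  simpa using (IsOp.one.smul 0).mono (Nat.zero_le k)

theorem IsOp.neg (h : IsOp k T) : IsOp k (-T) := by
  simpa using h.smul (-1)

theorem IsOp.sum {ι : Type*} {s : Finset ι} {T : ι → Op d} (h : ∀ i ∈ s, IsOp k (T i)) :
    IsOp k (∑ i ∈ s, T i) := Finset.sum_induction _ (IsOp k) (fun _ _ => IsOp.add) IsOp.zero h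

theorem IsOp.coord (j : Fin d) : IsOp 1 (coordOp j) := IsOp.mul (hasBoundedDerivs_coord j)

/-- An induction principle for the operators `x^α ∂^β`. -/
theorem weighted_induction {P : ℕ → Op d → Prop} (h1 : P 0 1)
    (hx : ∀ j, P 1 (coordOp j)) (hd : ∀ j, P 1 (pderiv j))
    (hc : ∀ k l S T, P k S → P l T → P (k + l) (S * T)) (α β : Fin d → ℕ) :
    P (∑ i, α i + ∑ i, β i) (weighted α β) := by
  have hpow : ∀ (n : ℕ) (S : Op d), P 1 S → P n (S ^ n) := by
    intro n S hS
    induction n with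
    | zero => exact h1
    | succ n ih => rw [pow_succ]; exact hc _ _ _ _ ih hS
  have hD : ∀ l : List (Fin d), P (l.map β).sum (l.map fun j => pderiv j ^ β j).prod := by
    intro l
    induction l with
    | nil => exact h1
    | cons j l ih =>
      simp only [List.map_cons, List.sum_cons, List.prod_cons]
      exact hc _ _ _ _ (hpow _ _ (hd j)) ih
  have hcoord : ∀ i : Fin d, (fun x : E d => x i).HasTemperateGrowth := fun i =>
    (hasBoundedDerivs_coord i).hasTemperateGrowth
  have hX1 : ∀ (i : Fin d) (n : ℕ), (fun x : E d => x i ^ n).HasTemperateGrowth ∧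
      P n (mulOp fun x => x i ^ n) := by
    intro i n
    refine ⟨(hcoord i).pow n, ?_⟩
    induction n with
    | zero => simpa [mulOp_const] using h1
    | succ n ih =>
      have : mulOp (fun x : E d => x i ^ (n + 1)) = mulOp (fun x => x i ^ n) * coordOp i := by
        have h : (fun x : E d => x i ^ n).HasTemperateGrowth := (hcoord i).pow n
        rw [coordOp, mulOp_mul h (hcoord i)]
        simp only [pow_succ]
      rw [this]
      exact hc _ _ _ _ ih (hx i)
  have hX : ∀ s : Finset (Fin d), (fun x : E d => ∏ i ∈ s, x i ^ α i).HasTemperateGrowth ∧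
      P (∑ i ∈ s, α i) (mulOp fun x => ∏ i ∈ s, x i ^ α i) := by
    intro s
    induction s using Finset.induction_on with
    | empty => exact ⟨by simp, by simpa [mulOp_const] using h1⟩
    | insert i s hi ih =>
      simp only [Finset.prod_insert hi, Finset.sum_insert hi]
      refine ⟨(hX1 i _).1.mul ih.1, ?_⟩
      rw [← mulOp_mul (hX1 i _).1 ih.1]
      exact hc _ _ _ _ (hX1 i _).2 ih.2
  have := hc _ _ _ _ (hX Finset.univ).2 (hD (List.finRange d))
  rw [← List.sum_ofFn, List.ofFn_eq_map]
  exact this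

theorem isOp_weighted (α β : Fin d → ℕ) : IsOp (∑ i, α i + ∑ i, β i) (weighted α β) :=
  weighted_induction (P := IsOp) IsOp.one IsOp.coord IsOp.deriv (fun _ _ _ _ => IsOp.comp) α β

/-! ### The norms defined by words in the `x_j` and `∂_j` -/

/-- The sum of the `L²` norms of `W φ`, over all words `W` of length at most `m` in the `x_j` and
the `∂_j` (with multiplicities). -/
def wordNorm (d : ℕ) : ℕ → Seminorm ℝ 𝓢(E d, ℝ)
  | 0 => (normSeminorm ℝ (Lp ℝ 2 (volume : Measure (E d)))).comp
      (toLpCLM ℝ ℝ 2 volume).toLinearMap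
  -- The new letter acts first, directly on `φ`; an induction on `m` then only has to move a
  -- multiplication operator past one letter.
  | m + 1 => wordNorm d m + ∑ j, (wordNorm d m).comp (coordOp j).toLinearMap +
      ∑ j, (wordNorm d m).comp (pderiv j).toLinearMap

theorem wordNorm_zero (φ : 𝓢(E d, ℝ)) : wordNorm d 0 φ = ‖toLpCLM ℝ ℝ 2 volume φ‖ := rfl

theorem wordNorm_succ (m : ℕ) (φ : 𝓢(E d, ℝ)) :
    wordNorm d (m + 1) φ = wordNorm d m φ + ∑ j, wordNorm d m (coordOp j φ) +
      ∑ j, wordNorm d m (pderiv j φ) := by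
  rw [wordNorm, add_apply, add_apply, sum_apply, sum_apply]
  rfl

theorem wordNorm_le_succ (m : ℕ) (φ : 𝓢(E d, ℝ)) : wordNorm d m φ ≤ wordNorm d (m + 1) φ := by
  rw [wordNorm_succ]
  have h1 : 0 ≤ ∑ j, wordNorm d m (coordOp j φ) := Finset.sum_nonneg fun _ _ => apply_nonneg _ _
  have h2 : 0 ≤ ∑ j, wordNorm d m (pderiv j φ) := Finset.sum_nonneg fun _ _ => apply_nonneg _ _
  linarith

theorem wordNorm_mono {m n : ℕ} (h : m ≤ n) (φ : 𝓢(E d, ℝ)) : wordNorm d m φ ≤ wordNorm d n φ :=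
  monotone_nat_of_le_succ (f := fun m => wordNorm d m φ) (fun m => wordNorm_le_succ m φ) h

theorem wordNorm_coordOp_le (m : ℕ) (j : Fin d) (φ : 𝓢(E d, ℝ)) :
    wordNorm d m (coordOp j φ) ≤ wordNorm d (m + 1) φ := by
  rw [wordNorm_succ]
  have h0 : 0 ≤ wordNorm d m φ := apply_nonneg _ _
  have h1 := Finset.single_le_sum (f := fun j => wordNorm d m (coordOp j φ))
    (fun _ _ => apply_nonneg _ _) (Finset.mem_univ j)
  have h2 : 0 ≤ ∑ j, wordNorm d m (pderiv j φ) := Finset.sum_nonneg fun _ _ => apply_nonneg _ _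
  linarith

theorem wordNorm_pderiv_le (m : ℕ) (j : Fin d) (φ : 𝓢(E d, ℝ)) :
    wordNorm d m (pderiv j φ) ≤ wordNorm d (m + 1) φ := by
  rw [wordNorm_succ]
  have h0 : 0 ≤ wordNorm d m φ := apply_nonneg _ _
  have h1 := Finset.single_le_sum (f := fun j => wordNorm d m (pderiv j φ))
    (fun _ _ => apply_nonneg _ _) (Finset.mem_univ j)
  have h2 : 0 ≤ ∑ j, wordNorm d m (coordOp j φ) := Finset.sum_nonneg fun _ _ => apply_nonneg _ _
  linarith

theorem norm_toLp_le_of_abs_le {φ ψ : 𝓢(E d, ℝ)} {C : ℝ} (h : ∀ x, |φ x| ≤ C * |ψ x|) :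
    ‖toLpCLM ℝ ℝ 2 volume φ‖ ≤ C * ‖toLpCLM ℝ ℝ 2 volume ψ‖ := by
  refine Lp.norm_le_mul_norm_of_ae_le_mul ?_
  filter_upwards [φ.coeFn_toLp 2 volume, ψ.coeFn_toLp 2 volume] with x hx hy
  simpa only [toLpCLM_apply, hx, hy, Real.norm_eq_abs] using h x

/-- Induction on the word length: `a` commutes with `x_j`, and passing it through `∂_j` produces the
extra factor `∂_j a`, again bounded and smooth, under a shorter word. Hence `a` has to vary in the
induction. -/
theorem wordNorm_mulOp_le (m : ℕ) (ha : IsBddSmooth a) :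
    ∃ C : ℝ, 0 ≤ C ∧ ∀ φ, wordNorm d m (mulOp a φ) ≤ C * wordNorm d m φ := by
  induction m generalizing a with
  | zero =>
    obtain ⟨M, hM0, hM⟩ := ha.bounded
    refine ⟨M, hM0, fun φ => norm_toLp_le_of_abs_le fun x => ?_⟩
    rw [mulOp_apply ha.hasTemperateGrowth, abs_mul]
    exact mul_le_mul_of_nonneg_right (hM x) (abs_nonneg _)
  | succ m ih =>
    obtain ⟨C, hC0, hC⟩ := ih ha
    choose K hK0 hK using fun j => ih (ha.partialDeriv j)
    have hK0' : 0 ≤ ∑ j, K j := Finset.sum_nonneg fun j _ => hK0 j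
    refine ⟨C + ∑ j, K j, by positivity, fun φ => ?_⟩
    have hx : ∀ j, coordOp j (mulOp a φ) = mulOp a (coordOp j φ) := fun j =>
      congrArg (fun T : Op d => T φ) (mulOp_comm (hasBoundedDerivs_coord j).hasTemperateGrowth
        ha.hasTemperateGrowth)
    have hd : ∀ j, pderiv j (mulOp a φ) = mulOp a (pderiv j φ) + mulOp (partialDeriv j a) φ :=
      fun j => congrArg (fun T : Op d => T φ) (pderiv_mulOp ha.hasBoundedDerivs j)
    rw [wordNorm_succ]
    have e1 : ∑ j, wordNorm d m (coordOp j (mulOp a φ)) ≤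
        C * ∑ j, wordNorm d m (coordOp j φ) := by
      rw [Finset.mul_sum]
      exact Finset.sum_le_sum fun j _ => by rw [hx]; exact hC _
    have e2 : ∑ j, wordNorm d m (pderiv j (mulOp a φ)) ≤
        C * ∑ j, wordNorm d m (pderiv j φ) + (∑ j, K j) * wordNorm d m φ := by
      rw [Finset.mul_sum, Finset.sum_mul, ← Finset.sum_add_distrib]
      refine Finset.sum_le_sum fun j _ => ?_
      rw [hd]
      exact (map_add_le_add _ _ _).trans (add_le_add (hC _) (hK j φ))
    have e3 := hC φ
    have e4 := mul_le_mul_of_nonneg_left (wordNorm_le_succ m φ) hK0'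
    have e5 : C * wordNorm d (m + 1) φ = C * wordNorm d m φ +
        C * ∑ j, wordNorm d m (coordOp j φ) + C * ∑ j, wordNorm d m (pderiv j φ) := by
      rw [wordNorm_succ]; ring
    rw [add_mul]
    linarith

/-- The mean value inequality gives linear growth. The norm of `x` is replaced by `∑ |x_j|` because
the `x_j` are letters of the word norms. -/
theorem HasBoundedDerivs.abs_le (ha : HasBoundedDerivs a) :
    ∃ M : ℝ, 0 ≤ M ∧ ∀ x, |a x| ≤ M * (1 + ∑ j, |x j|) := by
  obtain ⟨M, hM⟩ := ha.2 1 le_rfl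
  have hM' : ∀ x, ‖fderiv ℝ a x‖ ≤ M := fun x => by
    simpa only [norm_iteratedFDeriv_one] using hM x
  have hM0 : 0 ≤ M := (norm_nonneg _).trans (hM' 0)
  refine ⟨|a 0| + M, by positivity, fun x => ?_⟩
  have h1 := Convex.norm_image_sub_le_of_norm_fderiv_le (𝕜 := ℝ)
    (fun y _ => ha.1.differentiable (by simp) y) (fun y _ => hM' y)
    convex_univ (Set.mem_univ 0) (Set.mem_univ x)
  rw [sub_zero, Real.norm_eq_abs] at h1
  have h2 : |a x| ≤ |a x - a 0| + |a 0| := by simpa using abs_add_le (a x - a 0) (a 0)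
  have h3 : ‖x‖ ≤ ∑ j, |x j| := by
    rw [EuclideanSpace.norm_eq]
    refine Real.sqrt_le_iff.2 ⟨Finset.sum_nonneg fun _ _ => abs_nonneg _, ?_⟩
    simpa using Finset.sum_sq_le_sq_sum_of_nonneg (s := Finset.univ) (f := fun j => |x j|)
      fun _ _ => abs_nonneg _
  have h4 : 0 ≤ ∑ j, |x j| := Finset.sum_nonneg fun _ _ => abs_nonneg _
  nlinarith [mul_le_mul_of_nonneg_left h3 hM0, mul_nonneg (abs_nonneg (a 0)) h4]

/-- The product `(1 + ∑ |x_j|) |φ|` need not be a Schwartz function, so it is built in `L²` as a sum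
of the absolute values of `φ` and of the `x_j φ`; the triangle inequality bounds its norm. -/
theorem exists_toLp_dominating (φ : 𝓢(E d, ℝ)) (s : Finset (Fin d)) :
    ∃ g : Lp ℝ 2 (volume : Measure (E d)),
      ‖g‖ ≤ wordNorm d 0 φ + ∑ j ∈ s, wordNorm d 0 (coordOp j φ) ∧
      ∀ᵐ x : E d, g x = (1 + ∑ j ∈ s, |x j|) * |φ x| := by
  induction s using Finset.induction_on with
  | empty =>
    refine ⟨|toLpCLM ℝ ℝ 2 volume φ|, by rw [norm_abs_eq_norm]; simp [wordNorm_zero], ?_⟩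
    filter_upwards [Lp.coeFn_abs (toLpCLM ℝ ℝ 2 volume φ), φ.coeFn_toLp 2 volume] with x h1 h2
    rw [h1, toLpCLM_apply, h2]
    simp
  | insert i s hi ih =>
    obtain ⟨g, hg, hg'⟩ := ih
    refine ⟨g + |toLpCLM ℝ ℝ 2 volume (coordOp i φ)|, ?_, ?_⟩
    · rw [Finset.sum_insert hi]
      refine (norm_add_le _ _).trans ?_
      rw [norm_abs_eq_norm, ← wordNorm_zero]
      linarith
    · filter_upwards [Lp.coeFn_add g |toLpCLM ℝ ℝ 2 volume (coordOp i φ)|,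
        Lp.coeFn_abs (toLpCLM ℝ ℝ 2 volume (coordOp i φ)),
        (coordOp i φ).coeFn_toLp 2 volume, hg'] with x h0 h1 h2 h3
      rw [h0, Pi.add_apply, h1, toLpCLM_apply, h2, h3, Finset.sum_insert hi, coordOp,
        mulOp_apply (hasBoundedDerivs_coord i).hasTemperateGrowth, abs_mul]
      ring

/-- Linear growth costs one factor `x_j` in the base case. In the induction step the commutator
terms involve only the bounded functions `∂_j a`, so they cost nothing more. -/
theorem wordNorm_mulOp_le_succ (m : ℕ) (ha : HasBoundedDerivs a) :
    ∃ C : ℝ, 0 ≤ C ∧ ∀ φ, wordNorm d m (mulOp a φ) ≤ C * wordNorm d (m + 1) φ := by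
  induction m generalizing a with
  | zero =>
    obtain ⟨M, hM0, hM⟩ := ha.abs_le
    refine ⟨M, hM0, fun φ => ?_⟩
    obtain ⟨g, hg, hg'⟩ := exists_toLp_dominating φ Finset.univ
    have h1 : ‖toLpCLM ℝ ℝ 2 volume (mulOp a φ)‖ ≤ M * ‖g‖ := by
      refine Lp.norm_le_mul_norm_of_ae_le_mul ?_
      filter_upwards [(mulOp a φ).coeFn_toLp 2 volume, hg'] with x hx hgx
      rw [toLpCLM_apply, hx, hgx, mulOp_apply ha.hasTemperateGrowth, Real.norm_eq_abs,
        Real.norm_eq_abs, abs_mul, abs_mul, abs_abs, ← mul_assoc]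
      exact mul_le_mul_of_nonneg_right ((hM x).trans
        (mul_le_mul_of_nonneg_left (le_abs_self _) hM0)) (abs_nonneg _)
    have h2 : ‖g‖ ≤ wordNorm d 1 φ := by
      rw [wordNorm_succ]
      exact hg.trans (le_add_of_nonneg_right (Finset.sum_nonneg fun _ _ => apply_nonneg _ _))
    exact h1.trans (mul_le_mul_of_nonneg_left h2 hM0)
  | succ m ih =>
    obtain ⟨C, hC0, hC⟩ := ih ha
    choose K hK0 hK using fun j => wordNorm_mulOp_le m (ha.partialDeriv j)
    have hK0' : 0 ≤ ∑ j, K j := Finset.sum_nonneg fun j _ => hK0 j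
    refine ⟨C + d * C + d * C + ∑ j, K j, by positivity, fun φ => ?_⟩
    have hx : ∀ j, coordOp j (mulOp a φ) = mulOp a (coordOp j φ) := fun j =>
      congrArg (fun T : Op d => T φ) (mulOp_comm (hasBoundedDerivs_coord j).hasTemperateGrowth
        ha.hasTemperateGrowth)
    have hd : ∀ j, pderiv j (mulOp a φ) = mulOp a (pderiv j φ) + mulOp (partialDeriv j a) φ :=
      fun j => congrArg (fun T : Op d => T φ) (pderiv_mulOp ha j)
    rw [wordNorm_succ]
    have e1 : ∑ j, wordNorm d m (coordOp j (mulOp a φ)) ≤ d * C * wordNorm d (m + 2) φ := by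
      have : ∑ _j : Fin d, C * wordNorm d (m + 2) φ = d * C * wordNorm d (m + 2) φ := by
        simp [mul_assoc]
      rw [← this]
      refine Finset.sum_le_sum fun j _ => ?_
      rw [hx]
      exact (hC _).trans (mul_le_mul_of_nonneg_left (wordNorm_coordOp_le _ _ _) hC0)
    have e2 : ∑ j, wordNorm d m (pderiv j (mulOp a φ)) ≤
        d * C * wordNorm d (m + 2) φ + (∑ j, K j) * wordNorm d (m + 2) φ := by
      have : ∑ _j : Fin d, C * wordNorm d (m + 2) φ = d * C * wordNorm d (m + 2) φ := by
        simp [mul_assoc]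
      rw [← this, Finset.sum_mul, ← Finset.sum_add_distrib]
      refine Finset.sum_le_sum fun j _ => ?_
      rw [hd]
      refine (map_add_le_add _ _ _).trans (add_le_add ?_ ?_)
      · exact (hC _).trans (mul_le_mul_of_nonneg_left (wordNorm_pderiv_le _ _ _) hC0)
      · exact (hK j φ).trans (mul_le_mul_of_nonneg_left (wordNorm_mono (by omega) _) (hK0 j))
    have e3 := (hC φ).trans (mul_le_mul_of_nonneg_left (wordNorm_le_succ (m + 1) φ) hC0)
    simp only [add_mul]
    linarith

/-- An operator of order `k` maps the norm of index `m + k` to the norm of index `m`. -/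
theorem IsOp.wordNorm_le (h : IsOp k T) (m : ℕ) :
    ∃ C : ℝ, 0 ≤ C ∧ ∀ φ, wordNorm d m (T φ) ≤ C * wordNorm d (m + k) φ := by
  induction h generalizing m with
  | mul_bdd ha => exact wordNorm_mulOp_le m ha
  | mul ha => exact wordNorm_mulOp_le_succ m ha
  | deriv j => exact ⟨1, zero_le_one, fun φ => by simpa using wordNorm_pderiv_le m j φ⟩
  | @comp k l S T _ _ ihS ihT =>
    obtain ⟨C, hC0, hC⟩ := ihS m
    obtain ⟨K, hK0, hK⟩ := ihT (m + k)
    refine ⟨C * K, by positivity, fun φ => (hC _).trans ?_⟩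
    rw [mul_assoc, ← add_assoc]
    exact mul_le_mul_of_nonneg_left (hK φ) hC0
  | add _ _ ihS ihT =>
    obtain ⟨C, hC0, hC⟩ := ihS m
    obtain ⟨K, hK0, hK⟩ := ihT m
    refine ⟨C + K, by positivity, fun φ => (map_add_le_add _ _ _).trans ?_⟩
    rw [add_mul]
    exact add_le_add (hC φ) (hK φ)
  | mono hkl _ ih =>
    obtain ⟨C, hC0, hC⟩ := ih m
    exact ⟨C, hC0, fun φ => (hC φ).trans
      (mul_le_mul_of_nonneg_left (wordNorm_mono (by omega) _) hC0)⟩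

end

section

/-! ### Comparison of the word norms with `‖·‖_p` -/

variable {d : ℕ} {k : ℕ} {S T : Op d}

theorem coordOp_mul_weighted (j : Fin d) (α β : Fin d → ℕ) :
    coordOp j * weighted α β = weighted (α + Pi.single j 1) β := by
  ext φ x
  rw [mul_apply_eq_comp, coordOp, mulOp_apply (hasBoundedDerivs_coord j).hasTemperateGrowth,
    weighted_apply, weighted_apply, ← mul_assoc]
  congr 1
  simp only [monomial, Pi.add_apply, pow_add, Finset.prod_mul_distrib]
  rw [mul_comm, Finset.prod_eq_single (f := fun i => x i ^ (Pi.single j 1 : Fin d → ℕ) i) j]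
  · simp
  · intro i _ hi
    simp [hi]
  · simp

/-- When `α j = 0` the truncated subtraction leaves `α` unchanged, but the factor `α j` kills the
term. -/
theorem partialDeriv_monomial (j : Fin d) (α : Fin d → ℕ) :
    partialDeriv j (monomial α) = fun x => (α j : ℝ) * monomial (α - Pi.single j 1) x := by
  funext x
  have hc : ∀ i : Fin d, HasFDerivAt (fun x : E d => x i)
      (EuclideanSpace.proj i : E d →L[ℝ] ℝ) x := fun i =>
    (EuclideanSpace.proj i : E d →L[ℝ] ℝ).hasFDerivAt
  have h := HasFDerivAt.finsetProd (u := Finset.univ) (fun i _ => (hc i).pow (α i))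
  have h' : HasFDerivAt (monomial α) _ x := h
  rw [partialDeriv, h'.fderiv, sum_apply, Finset.sum_eq_single j]
  · have : monomial (α - Pi.single j 1) x
        = (∏ i ∈ Finset.univ.erase j, x i ^ α i) * x j ^ (α j - 1) := by
      rw [monomial, ← Finset.prod_erase_mul _ _ (Finset.mem_univ j)]
      congr 1
      · refine Finset.prod_congr rfl fun i hi => ?_
        simp [Finset.ne_of_mem_erase hi]
      · simp
    rw [this]
    simp
    ring
  · intro i _ hi
    simp [hi]
  · simp

/-- The new `∂_j` commutes past the factors preceding its own in the ordered product. The induction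
runs over duplicate-free lists, so that exactly one exponent changes. -/
theorem pderiv_mul_mderiv (j : Fin d) (β : Fin d → ℕ) :
    pderiv j * mderiv β = mderiv (β + Pi.single j 1) := by
  have h0 : ∀ l : List (Fin d), j ∉ l →
      (l.map fun i => pderiv i ^ (β + Pi.single j 1 : Fin d → ℕ) i : List (Op d)).prod
        = (l.map fun i => pderiv i ^ β i).prod := by
    intro l hl
    congr 1
    refine List.map_congr_left fun i hi => ?_
    have : i ≠ j := fun h => hl (h ▸ hi)
    simp [this]
  have h : ∀ l : List (Fin d), l.Nodup → j ∈ l →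
      pderiv j * (l.map fun i => pderiv i ^ β i : List (Op d)).prod
        = (l.map fun i => pderiv i ^ (β + Pi.single j 1 : Fin d → ℕ) i).prod := by
    intro l
    induction l with
    | nil => simp
    | cons i l ih =>
      intro hl hj
      rw [List.nodup_cons] at hl
      simp only [List.map_cons, List.prod_cons]
      by_cases hij : i = j
      · subst hij
        rw [h0 l hl.1, ← mul_assoc, ← pow_succ']
        simp
      · have hjl : j ∈ l := by
          rcases List.mem_cons.1 hj with h | h
          · exact absurd h.symm hij
          · exact h
        have hc : Commute (pderiv j : Op d) (pderiv i ^ β i) :=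
          Commute.pow_right (pderiv_comm j i) _
        rw [← mul_assoc, hc.eq, mul_assoc, ih hl.2 hjl]
        simp [hij]
  exact h _ (List.nodup_finRange d) (List.mem_finRange j)

theorem weighted_eq (α β : Fin d → ℕ) : weighted α β = mulOp (monomial α) * mderiv β := rfl

theorem pderiv_mul_weighted (j : Fin d) (α β : Fin d → ℕ) :
    pderiv j * weighted α β
      = weighted α (β + Pi.single j 1) + (α j : ℝ) • weighted (α - Pi.single j 1) β := by
  have ht := monomial_hasTemperateGrowth (d := d)
  have h1 : (partialDeriv j (monomial α)).HasTemperateGrowth := by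
    rw [partialDeriv_monomial]
    exact (Function.HasTemperateGrowth.const _).mul (ht _)
  have hd : Differentiable ℝ (monomial α : E d → ℝ) := (ht α).1.differentiable (by simp)
  rw [weighted_eq, ← mul_assoc, pderiv_mulOp_of_hasTemperateGrowth hd (ht α) h1, add_mul,
    mul_assoc, pderiv_mul_mderiv, partialDeriv_monomial, mulOp_const_mul _ (ht _), smul_mul_assoc]
  rfl

/-- The span of the operators `x^α ∂^β` with `|α| + |β| ≤ k`. -/
def weightedSpan (d k : ℕ) : Submodule ℝ (Op d) :=
  Submodule.span ℝ {T | ∃ α β : Fin d → ℕ, ∑ i, α i + ∑ i, β i ≤ k ∧ T = weighted α β}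

theorem weighted_mem_weightedSpan {α β : Fin d → ℕ} (h : ∑ i, α i + ∑ i, β i ≤ k) :
    weighted α β ∈ weightedSpan d k := Submodule.subset_span ⟨α, β, h, rfl⟩

theorem sum_add_single (α : Fin d → ℕ) (j : Fin d) :
    ∑ i, (α + Pi.single j 1 : Fin d → ℕ) i = ∑ i, α i + 1 := by
  simp [Finset.sum_add_distrib]

theorem coordOp_mul_mem_weightedSpan (j : Fin d) (h : T ∈ weightedSpan d k) :
    coordOp j * T ∈ weightedSpan d (k + 1) := by
  induction h using Submodule.span_induction with
  | mem T hT =>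
    obtain ⟨α, β, hab, rfl⟩ := hT
    rw [coordOp_mul_weighted]
    exact weighted_mem_weightedSpan (by rw [sum_add_single]; omega)
  | zero => rw [mul_zero]; exact zero_mem _
  | add S T _ _ hS hT => rw [mul_add]; exact add_mem hS hT
  | smul c T _ hT => rw [mul_smul_comm]; exact Submodule.smul_mem _ c hT

/-- Normal ordering: the Leibniz rule moves `∂_j` to the right of `x^α`, and the remainder carries
no more weights than before. -/
theorem pderiv_mul_mem_weightedSpan (j : Fin d) (h : T ∈ weightedSpan d k) :
    pderiv j * T ∈ weightedSpan d (k + 1) := by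
  induction h using Submodule.span_induction with
  | mem T hT =>
    obtain ⟨α, β, hab, rfl⟩ := hT
    rw [pderiv_mul_weighted]
    refine add_mem (weighted_mem_weightedSpan (by rw [sum_add_single]; omega))
      (Submodule.smul_mem _ _ (weighted_mem_weightedSpan ?_))
    have : ∑ i, (α - Pi.single j 1 : Fin d → ℕ) i ≤ ∑ i, α i :=
      Finset.sum_le_sum fun i _ => by simp
    omega
  | zero => rw [mul_zero]; exact zero_mem _
  | add S T _ _ hS hT => rw [mul_add]; exact add_mem hS hT
  | smul c T _ hT => rw [mul_smul_comm]; exact Submodule.smul_mem _ c hT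

theorem norm_toLp_weighted_le {p : ℕ} {α β : Fin d → ℕ} (h : ∑ i, α i + ∑ i, β i ≤ 2 * p)
    (φ : 𝓢(E d, ℝ)) : ‖toLpCLM ℝ ℝ 2 volume (weighted α β φ)‖ ≤ ‖toPre p φ‖ := by
  have h' : ∀ F : (Fin d → ℕ) × (Fin d → ℕ) → ℝ, (∀ ab, 0 ≤ F ab) →
      F (α, β) ≤ ∑ ab ∈ indexSet d p, F ab := fun F hF =>
    Finset.single_le_sum (fun ab _ => hF ab) ((mem_indexSet α β).2 h)
  rw [← sq_le_sq₀ (norm_nonneg _) (norm_nonneg _), norm_toPre_sq, schwartzInner_eq,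
    ← real_inner_self_eq_norm_sq]
  exact h' (fun ab => inner ℝ (toLpCLM ℝ ℝ 2 volume (weighted ab.1 ab.2 φ))
      (toLpCLM ℝ ℝ 2 volume (weighted ab.1 ab.2 φ))) fun ab => real_inner_self_nonneg

/-- Each letter taken off the word is absorbed into `T`, so `m` drops by one while `k` rises by one
and `m + k` is preserved; at `m = 0` only terms of `‖·‖_p` remain. -/
theorem wordNorm_le_of_mem_weightedSpan {p m : ℕ} (h : T ∈ weightedSpan d k)
    (hm : m + k ≤ 2 * p) :
    ∃ C : ℝ, 0 ≤ C ∧ ∀ φ, wordNorm d m (T φ) ≤ C * ‖toPre p φ‖ := by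
  induction m generalizing k T with
  | zero =>
    induction h using Submodule.span_induction with
    | mem T hT =>
      obtain ⟨α, β, hab, rfl⟩ := hT
      exact ⟨1, zero_le_one, fun φ => by
        rw [one_mul]; exact norm_toLp_weighted_le (by omega) φ⟩
    | zero => exact ⟨0, le_rfl, fun φ => by simp⟩
    | add S T _ _ hS hT =>
      obtain ⟨C, hC0, hC⟩ := hS
      obtain ⟨K, hK0, hK⟩ := hT
      refine ⟨C + K, by positivity, fun φ => (map_add_le_add _ _ _).trans ?_⟩
      rw [add_mul]
      exact add_le_add (hC φ) (hK φ)
    | smul c T _ hT =>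
      obtain ⟨C, hC0, hC⟩ := hT
      refine ⟨|c| * C, by positivity, fun φ => ?_⟩
      rw [smul_apply, map_smul_eq_mul, mul_assoc]
      exact mul_le_mul_of_nonneg_left (hC φ) (abs_nonneg c)
  | succ m ih =>
    obtain ⟨C, hC0, hC⟩ := ih h (by omega)
    choose K hK0 hK using fun j => ih (coordOp_mul_mem_weightedSpan j h) (by omega)
    choose M hM0 hM using fun j => ih (pderiv_mul_mem_weightedSpan j h) (by omega)
    refine ⟨C + ∑ j, K j + ∑ j, M j, add_nonneg (add_nonneg hC0
      (Finset.sum_nonneg fun j _ => hK0 j)) (Finset.sum_nonneg fun j _ => hM0 j), fun φ => ?_⟩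
    rw [wordNorm_succ, add_mul, add_mul, Finset.sum_mul, Finset.sum_mul]
    exact add_le_add (add_le_add (hC φ) (Finset.sum_le_sum fun j _ => hK j φ))
      (Finset.sum_le_sum fun j _ => hM j φ)

theorem wordNorm_le_norm_toPre (d p : ℕ) :
    ∃ C : ℝ, 0 ≤ C ∧ ∀ φ : 𝓢(E d, ℝ), wordNorm d (2 * p) φ ≤ C * ‖toPre p φ‖ := by
  have h : (1 : Op d) ∈ weightedSpan d 0 := by
    have : (1 : Op d) = weighted 0 0 := by
      ext φ x
      rw [weighted_zero]
      rfl
    rw [this]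
    exact weighted_mem_weightedSpan (by simp)
  exact wordNorm_le_of_mem_weightedSpan h le_rfl

theorem IsOp.norm_toLp_le {p : ℕ} (h : IsOp (2 * p) T) :
    ∃ C : ℝ, 0 ≤ C ∧ ∀ φ, ‖toLpCLM ℝ ℝ 2 volume (T φ)‖ ≤ C * ‖toPre p φ‖ := by
  obtain ⟨C, hC0, hC⟩ := h.wordNorm_le 0
  obtain ⟨K, hK0, hK⟩ := wordNorm_le_norm_toPre d p
  refine ⟨C * K, by positivity, fun φ => (hC φ).trans ?_⟩
  rw [zero_add, mul_assoc]
  exact mul_le_mul_of_nonneg_left (hK φ) hC0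

/-- Each `x^α ∂^β T` with `|α| + |β| ≤ 2 q` has order at most `2 q + k ≤ 2 p`, hence is bounded from
`‖·‖_p` to `L²`. -/
theorem IsOp.norm_toPre_le {p q : ℕ} (h : IsOp k T) (hk : 2 * q + k ≤ 2 * p) :
    ∃ C : ℝ, 0 ≤ C ∧ ∀ φ, ‖toPre q (T φ)‖ ≤ C * ‖toPre p φ‖ := by
  have h1 : ∀ ab : (Fin d → ℕ) × (Fin d → ℕ), ∃ C : ℝ, 0 ≤ C ∧ (ab ∈ indexSet d q → ∀ φ,
      ‖toLpCLM ℝ ℝ 2 volume (weighted ab.1 ab.2 (T φ))‖ ≤ C * ‖toPre p φ‖) := by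
    rintro ⟨α, β⟩
    by_cases hab : (α, β) ∈ indexSet d q
    · have hab' := (mem_indexSet α β).1 hab
      obtain ⟨C, hC0, hC⟩ := IsOp.norm_toLp_le (p := p)
        (((isOp_weighted α β).comp h).mono (by omega))
      exact ⟨C, hC0, fun _ => hC⟩
    -- A dummy constant outside the index set, so that the constants can be chosen for all pairs at
    -- once.
    · exact ⟨0, le_rfl, fun h => absurd h hab⟩
  choose C hC0 hC using h1
  refine ⟨∑ ab ∈ indexSet d q, C ab, Finset.sum_nonneg fun _ _ => hC0 _, fun φ => ?_⟩
  have hs : 0 ≤ ∑ ab ∈ indexSet d q, C ab := Finset.sum_nonneg fun _ _ => hC0 _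
  rw [← sq_le_sq₀ (norm_nonneg _) (by positivity), norm_toPre_sq, schwartzInner_eq, mul_pow]
  -- The sum of the squares of the nonnegative constants is at most the square of their sum.
  refine le_trans ?_ (mul_le_mul_of_nonneg_right
    (Finset.sum_sq_le_sq_sum_of_nonneg fun ab _ => hC0 ab) (sq_nonneg _))
  rw [Finset.sum_mul]
  refine Finset.sum_le_sum fun ab hab => ?_
  rw [real_inner_self_eq_norm_sq, ← mul_pow]
  exact pow_le_pow_left₀ (norm_nonneg _) (hC ab hab φ) 2

end

section

/-! ### First order operators -/

/-- The operator `∑ⱼ s_j ∂ⱼ + h`. -/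
def firstOrder {d : ℕ} (s : Fin d → E d → ℝ) (h : E d → ℝ) : Op d :=
  ∑ j, mulOp (s j) * pderiv j + mulOp h

variable {d : ℕ} {k : ℕ} {S T : Op d} {a : E d → ℝ} {s : Fin d → E d → ℝ} {h : E d → ℝ}

theorem firstOrder_apply (hs : ∀ j, (s j).HasTemperateGrowth) (hh : h.HasTemperateGrowth)
    (φ : 𝓢(E d, ℝ)) (x : E d) :
    firstOrder s h φ x = ∑ j, s j x * pderiv j φ x + h x * φ x := by
  simp only [firstOrder, add_apply, sum_apply, mul_apply_eq_comp, mulOp_apply hh,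
    mulOp_apply (hs _)]

/-- Up to its zeroth order part, which commutes with `a`, a first order operator is a derivation;
the commutator is thus a mere multiplication. -/
theorem firstOrder_mul_mulOp (hs : ∀ j, (s j).HasTemperateGrowth) (hh : h.HasTemperateGrowth)
    (ha : HasBoundedDerivs a) :
    firstOrder s h * mulOp a
      = mulOp a * firstOrder s h + mulOp (fun x => ∑ j, s j x * partialDeriv j a x) := by
  have h1 : ∀ j, (fun x => s j x * partialDeriv j a x).HasTemperateGrowth := fun j =>
    (hs j).mul (ha.partialDeriv j).hasTemperateGrowth
  rw [mulOp_sum fun j _ => h1 j, firstOrder, add_mul, mul_add, Finset.sum_mul, Finset.mul_sum,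
    mulOp_comm hh ha.hasTemperateGrowth, add_right_comm, ← Finset.sum_add_distrib]
  congr 1
  refine Finset.sum_congr rfl fun j _ => ?_
  rw [mul_assoc, pderiv_mulOp ha, mul_add, ← mul_assoc, ← mul_assoc,
    mulOp_comm (hs j) ha.hasTemperateGrowth, mulOp_mul (hs j) (ha.partialDeriv j).hasTemperateGrowth]

theorem pderiv_mul_firstOrder (hs : ∀ j, HasBoundedDerivs (s j)) (hh : HasBoundedDerivs h)
    (i : Fin d) :
    pderiv i * firstOrder s h = firstOrder s h * pderiv i +
      firstOrder (fun j => partialDeriv i (s j)) (partialDeriv i h) := by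
  have key : ∑ j, pderiv i * (mulOp (s j) * pderiv j) =
      ∑ j, mulOp (s j) * pderiv j * pderiv i + ∑ j, mulOp (partialDeriv i (s j)) * pderiv j := by
    rw [← Finset.sum_add_distrib]
    refine Finset.sum_congr rfl fun j _ => ?_
    rw [← mul_assoc, pderiv_mulOp (hs j), add_mul, mul_assoc, mul_assoc, pderiv_comm i j]
  simp only [firstOrder]
  rw [mul_add, add_mul, Finset.mul_sum, Finset.sum_mul, key, pderiv_mulOp hh]
  abel

theorem isOp_firstOrder (hs : ∀ j, IsBddSmooth (s j)) (hh : IsBddSmooth h) :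
    IsOp 1 (firstOrder s h) :=
  (IsOp.sum fun j _ => ((IsOp.mul_bdd (hs j)).comp (IsOp.deriv j)).mono (by omega)).add
    ((IsOp.mul_bdd hh).mono (by omega))

theorem isOp_firstOrder_of_hasBoundedDerivs (hs : ∀ j, HasBoundedDerivs (s j))
    (hh : IsBddSmooth h) : IsOp 2 (firstOrder s h) :=
  (IsOp.sum fun j _ => (IsOp.mul (hs j)).comp (IsOp.deriv j)).add
    ((IsOp.mul_bdd hh).mono (by omega))

/-- Commutation with a first order operator with bounded coefficients preserves the order. -/
theorem IsOp.commutator (hs : ∀ j, IsBddSmooth (s j)) (hh : IsBddSmooth h) (hT : IsOp k T) :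
    IsOp k (T * firstOrder s h - firstOrder s h * T) := by
  -- The commutator is multiplication by `-∑ⱼ s_j ∂ⱼ a`, which is bounded even if `a` grows, because
  -- the `s_j` are bounded here.
  have hmul : ∀ {a : E d → ℝ}, HasBoundedDerivs a →
      IsOp 0 (mulOp a * firstOrder s h - firstOrder s h * mulOp a) := by
    intro a ha
    rw [firstOrder_mul_mulOp (fun j => (hs j).hasTemperateGrowth) hh.hasTemperateGrowth ha,
      sub_add_cancel_left]
    exact (IsOp.mul_bdd (.sum fun j _ => (hs j).mul (ha.partialDeriv j))).neg
  induction hT with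
  | mul_bdd ha => exact hmul ha.hasBoundedDerivs
  | mul ha => exact (hmul ha).mono (by omega)
  | deriv j =>
    rw [pderiv_mul_firstOrder (fun j => (hs j).hasBoundedDerivs) hh.hasBoundedDerivs,
      add_sub_cancel_left]
    exact isOp_firstOrder (fun i => (hs i).partialDeriv j) (hh.partialDeriv j)
  | @comp k l S T hS hT ihS ihT =>
    -- The commutator is a derivation in its first argument.
    have : S * T * firstOrder s h - firstOrder s h * (S * T) =
        S * (T * firstOrder s h - firstOrder s h * T) +
          (S * firstOrder s h - firstOrder s h * S) * T := by noncomm_ring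
    rw [this]
    exact (hS.comp ihT).add (ihS.comp hT)
  | @add k S T _ _ ihS ihT =>
    have : (S + T) * firstOrder s h - firstOrder s h * (S + T) =
        (S * firstOrder s h - firstOrder s h * S) +
          (T * firstOrder s h - firstOrder s h * T) := by noncomm_ring
    rw [this]
    exact ihS.add ihT
  | mono hkl _ ih => exact ih.mono hkl

/-- Commutation of `x^α ∂^β` with a first order operator whose coefficients have bounded
derivatives preserves the order. -/
theorem isOp_commutator_weighted (hs : ∀ j, HasBoundedDerivs (s j)) (hh : HasBoundedDerivs h)
    (α β : Fin d → ℕ) :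
    IsOp (∑ i, α i + ∑ i, β i)
      (weighted α β * firstOrder s h - firstOrder s h * weighted α β) := by
  -- Only words in the `x_i` and `∂_i` are admitted: commuting with a general bounded `a` would give
  -- `∑ⱼ s_j ∂ⱼ a`, which can be unbounded when the `s_j` grow.
  refine (weighted_induction (P := fun k T => IsOp k T ∧
    IsOp k (T * firstOrder s h - firstOrder s h * T)) ?_ ?_ ?_ ?_ α β).2
  · exact ⟨IsOp.one, by simpa using IsOp.zero⟩
  · refine fun i => ⟨IsOp.coord i, ?_⟩
    -- The commutator of `x_i` with the operator is `-s_i`, which grows at most linearly and so has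
    -- order one, like `x_i` itself.
    have : (fun x => ∑ j, s j x * partialDeriv j (fun x : E d => x i) x) = s i := by
      funext x
      simp [partialDeriv_coord]
    rw [coordOp, firstOrder_mul_mulOp (fun j => (hs j).hasTemperateGrowth) hh.hasTemperateGrowth
      (hasBoundedDerivs_coord i), sub_add_cancel_left, this]
    exact (IsOp.mul (hs i)).neg
  · refine fun i => ⟨IsOp.deriv i, ?_⟩
    rw [pderiv_mul_firstOrder hs hh, add_sub_cancel_left]
    exact isOp_firstOrder (fun j => (hs j).partialDeriv i) (hh.partialDeriv i)
  · rintro k l S T ⟨hS, ihS⟩ ⟨hT, ihT⟩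
    refine ⟨hS.comp hT, ?_⟩
    have : S * T * firstOrder s h - firstOrder s h * (S * T) =
        S * (T * firstOrder s h - firstOrder s h * T) +
          (S * firstOrder s h - firstOrder s h * S) * T := by noncomm_ring
    rw [this]
    exact (hS.comp ihT).add (ihS.comp hT)

/-! ### The `L²` pairing -/

/-- The `L²` inner product of Schwartz functions. -/
def l2Inner (d : ℕ) : 𝓢(E d, ℝ) →ₗ[ℝ] 𝓢(E d, ℝ) →ₗ[ℝ] ℝ :=
  (innerₗ (Lp ℝ 2 (volume : Measure (E d)))).compl₁₂ (toLpCLM ℝ ℝ 2 volume).toLinearMap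
    (toLpCLM ℝ ℝ 2 volume).toLinearMap

theorem l2Inner_apply (u v : 𝓢(E d, ℝ)) :
    l2Inner d u v = inner ℝ (toLpCLM ℝ ℝ 2 volume u) (toLpCLM ℝ ℝ 2 volume v) := rfl

theorem l2Inner_eq_integral (u v : 𝓢(E d, ℝ)) : l2Inner d u v = ∫ x, u x * v x :=
  inner_toLp u v

theorem l2Inner_comm (u v : 𝓢(E d, ℝ)) : l2Inner d u v = l2Inner d v u := by
  rw [l2Inner_apply, l2Inner_apply, real_inner_comm]

theorem l2Inner_mulOp (ha : a.HasTemperateGrowth) (u v : 𝓢(E d, ℝ)) :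
    l2Inner d u (mulOp a v) = l2Inner d (mulOp a u) v := by
  rw [l2Inner_eq_integral, l2Inner_eq_integral]
  refine integral_congr_ae (.of_forall fun x => ?_)
  simp only [mulOp_apply ha]
  ring

theorem l2Inner_pderiv (j : Fin d) (u v : 𝓢(E d, ℝ)) :
    l2Inner d u (pderiv j v) = -l2Inner d (pderiv j u) v := by
  rw [l2Inner_eq_integral u, ← neg_neg (∫ x, _), ← integral_neg]
  have := adjoint_pderiv j u v
  simp only [neg_apply, mul_neg] at this
  rw [← this, ← l2Inner_eq_integral]

/-- The zeroth order part `2 h - ∑ⱼ ∂ⱼ s_j` of the adjoint of `∑ⱼ s_j ∂ⱼ + h`. -/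
def adjointCoeff (s : Fin d → E d → ℝ) (h : E d → ℝ) (x : E d) : ℝ :=
  2 * h x + -∑ j, partialDeriv j (s j) x

theorem isBddSmooth_adjointCoeff (hs : ∀ j, HasBoundedDerivs (s j)) (hh : IsBddSmooth h) :
    IsBddSmooth (adjointCoeff s h) :=
  (hh.const_mul 2).add (IsBddSmooth.neg (.sum fun j _ => (hs j).partialDeriv j))

/-- Integration by parts. The adjoint is written as minus the whole operator, zeroth order part
included, which accounts for the `2 h` in `adjointCoeff`. -/
theorem l2Inner_firstOrder (hs : ∀ j, HasBoundedDerivs (s j)) (hh : IsBddSmooth h)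
    (u v : 𝓢(E d, ℝ)) :
    l2Inner d u (firstOrder s h v)
      = -l2Inner d (firstOrder s h u) v + l2Inner d (mulOp (adjointCoeff s h) u) v := by
  have hd : ∀ j, IsBddSmooth (partialDeriv j (s j)) := fun j => (hs j).partialDeriv j
  have hc : mulOp (adjointCoeff s h) = (2 : ℝ) • mulOp h + -∑ j, mulOp (partialDeriv j (s j)) := by
    have h1 : IsBddSmooth fun x => ∑ j, partialDeriv j (s j) x := .sum fun j _ => hd j
    rw [← mulOp_sum fun j _ => (hd j).hasTemperateGrowth, ← mulOp_neg h1.hasTemperateGrowth,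
      ← mulOp_const_mul 2 hh.hasTemperateGrowth,
      ← mulOp_add (hh.const_mul 2).hasTemperateGrowth h1.neg.hasTemperateGrowth]
    rfl
  have hj : ∀ j, l2Inner d u (mulOp (s j) (pderiv j v)) =
      -l2Inner d (mulOp (s j) (pderiv j u)) v - l2Inner d (mulOp (partialDeriv j (s j)) u) v := by
    intro j
    have : pderiv j (mulOp (s j) u) = mulOp (s j) (pderiv j u) + mulOp (partialDeriv j (s j)) u :=
      congrArg (fun T : Op d => T u) (pderiv_mulOp (hs j) j)
    rw [l2Inner_mulOp (hs j).hasTemperateGrowth, l2Inner_pderiv, this, map_add,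
      LinearMap.add_apply]
    ring
  rw [hc]
  simp only [firstOrder, add_apply, sum_apply, mul_apply_eq_comp, neg_apply, smul_apply, map_add,
    map_sum, map_neg, map_smul, LinearMap.add_apply, LinearMap.sum_apply, LinearMap.neg_apply,
    LinearMap.smul_apply, hj, Finset.sum_sub_distrib, Finset.sum_neg_distrib,
    l2Inner_mulOp hh.hasTemperateGrowth, smul_eq_mul]
  ring

/-! ### Quadratic forms bounded by `‖·‖_q²` -/

/-- The quadratic expression `Q` is at most a constant times `‖φ‖_q²`. -/
def IsQuadBounded (q : ℕ) (Q : 𝓢(E d, ℝ) → ℝ) : Prop :=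
  ∃ C : ℝ, ∀ φ, Q φ ≤ C * ‖toPre q φ‖ ^ 2

variable {q : ℕ}

theorem IsQuadBounded.add {Q R : 𝓢(E d, ℝ) → ℝ} (hQ : IsQuadBounded q Q)
    (hR : IsQuadBounded q R) : IsQuadBounded q fun φ => Q φ + R φ := by
  obtain ⟨C, hC⟩ := hQ
  obtain ⟨K, hK⟩ := hR
  exact ⟨C + K, fun φ => by rw [add_mul]; exact add_le_add (hC φ) (hK φ)⟩

theorem IsQuadBounded.sum {ι : Type*} {t : Finset ι} {Q : ι → 𝓢(E d, ℝ) → ℝ}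
    (hQ : ∀ i ∈ t, IsQuadBounded q (Q i)) : IsQuadBounded q fun φ => ∑ i ∈ t, Q i φ := by
  classical
  induction t using Finset.induction_on with
  | empty => exact ⟨0, fun φ => by simp⟩
  | insert i t hi ih =>
    simp only [Finset.sum_insert hi]
    exact (hQ i (Finset.mem_insert_self i t)).add
      (ih fun k hk => hQ k (Finset.mem_insert_of_mem hk))

/-- Cauchy–Schwarz in `L²`; the sign of `c` is immaterial since the pairing is bounded in absolute
value. -/
theorem isQuadBounded_l2Inner (c : ℝ) (hS : IsOp (2 * q) S) (hT : IsOp (2 * q) T) :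
    IsQuadBounded q fun φ => c * l2Inner d (S φ) (T φ) := by
  obtain ⟨C, hC0, hC⟩ := hS.norm_toLp_le
  obtain ⟨K, hK0, hK⟩ := hT.norm_toLp_le
  refine ⟨|c| * (C * K), fun φ => ?_⟩
  have h1 : |l2Inner d (S φ) (T φ)| ≤ C * K * ‖toPre q φ‖ ^ 2 := by
    rw [l2Inner_apply]
    refine (abs_real_inner_le_norm _ _).trans ?_
    refine (mul_le_mul (hC φ) (hK φ) (norm_nonneg _) (by positivity)).trans (le_of_eq ?_)
    ring
  refine (le_abs_self _).trans ?_
  rw [abs_mul, mul_assoc]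
  exact mul_le_mul_of_nonneg_left h1 (abs_nonneg c)

/-- The squares of first order operators with bounded coefficients. -/
theorem isQuadBounded_firstOrder_sq {D : Op d} (hs : ∀ j, IsBddSmooth (s j))
    (hh : IsBddSmooth h) (hD : IsOp (2 * q) D) :
    IsQuadBounded q fun φ => l2Inner d (D φ) (D (firstOrder s h (firstOrder s h φ))) +
      l2Inner d (D (firstOrder s h φ)) (D (firstOrder s h φ)) := by
  have hs' : ∀ j, HasBoundedDerivs (s j) := fun j => (hs j).hasBoundedDerivs
  have hc := isBddSmooth_adjointCoeff hs' hh
  have hadj := l2Inner_firstOrder hs' hh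
  set A := firstOrder s h
  set c := adjointCoeff s h
  have hR : IsOp (2 * q) (D * A - A * D) := hD.commutator hs hh
  have hR' := hR.commutator hs hh
  change IsOp _ ((D * A - A * D) * A - A * (D * A - A * D)) at hR'
  have hRA : ∀ φ, D (A φ) = A (D φ) + (D * A - A * D) φ := fun φ => by
    simp only [sub_apply, mul_apply_eq_comp]; abel
  have hRA' : ∀ φ, (D * A - A * D) (A φ) = A ((D * A - A * D) φ) +
      ((D * A - A * D) * A - A * (D * A - A * D)) φ := fun φ => by
    simp only [sub_apply, mul_apply_eq_comp]; abel
  generalize D * A - A * D = R at *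
  generalize R * A - A * R = R' at *
  have hc' : IsBddSmooth fun x => ∑ j, s j x * partialDeriv j c x :=
    .sum fun j _ => (hs j).mul (hc.partialDeriv j)
  have hAc : ∀ u, A (mulOp c u) = mulOp c (A u) +
      mulOp (fun x => ∑ j, s j x * partialDeriv j c x) u := fun u =>
    congrArg (fun T : Op d => T u) (firstOrder_mul_mulOp (fun j => (hs j).hasTemperateGrowth)
      hh.hasTemperateGrowth hc.hasBoundedDerivs)
  generalize (fun x => ∑ j, s j x * partialDeriv j c x) = c' at *
  have hM : ∀ {b : E d → ℝ}, IsBddSmooth b → ∀ {T : Op d}, IsOp (2 * q) T →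
      IsOp (2 * q) (mulOp b * T) := fun hb T hT => by
    simpa using (IsOp.mul_bdd hb).comp hT
  -- With `[A, c] = c'`, the adjoint formula for the pair `(c u, u)` reproduces its own left side
  -- with the opposite sign; solving for it removes the derivative in `A u`.
  have hcu : ∀ u, l2Inner d (mulOp c u) (A u) =
      (-1 / 2) * l2Inner d (mulOp c' u) u + (1 / 2) * l2Inner d (mulOp c (mulOp c u)) u := by
    intro u
    have h1 := hadj (mulOp c u) u
    rw [hAc, map_add, LinearMap.add_apply, ← l2Inner_mulOp hc.hasTemperateGrowth (A u) u,
      l2Inner_comm (A u)] at h1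
    linarith
  -- Put `u = D φ` and `w = D A φ = A u + R φ`. Then `D A² φ = A w + A R φ + R' φ`, and moving each
  -- `A` to the left factor turns `-⟨A u, w⟩ + ‖w‖²` into `⟨R φ, w⟩`. The terms `⟨A u, R φ⟩` cancel,
  -- and what remains of `A u` is `⟨c u, A u⟩`, given by `hcu`.
  have key : ∀ φ, l2Inner d (D φ) (D (A (A φ))) + l2Inner d (D (A φ)) (D (A φ)) =
      1 * l2Inner d (R φ) (R φ) + (-1 / 2) * l2Inner d ((mulOp c' * D) φ) (D φ) +
      (1 / 2) * l2Inner d ((mulOp c * (mulOp c * D)) φ) (D φ) +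
      2 * l2Inner d ((mulOp c * D) φ) (R φ) + 1 * l2Inner d (D φ) (R' φ) := by
    intro φ
    have h1 := hcu (D φ)
    have h2 := hadj (D φ) (D (A φ))
    have h3 := hadj (D φ) (R φ)
    have h4 := l2Inner_comm (A (D φ)) (R φ)
    simp only [mul_apply_eq_comp]
    rw [hRA (A φ), hRA' φ, map_add, map_add]
    rw [hRA φ] at h2 ⊢
    simp only [map_add, LinearMap.add_apply] at h2 ⊢
    linarith
  simp only [key]
  exact ((((isQuadBounded_l2Inner _ hR hR).add (isQuadBounded_l2Inner _ (hM hc' hD) hD)).add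
    (isQuadBounded_l2Inner _ (hM hc (hM hc hD)) hD)).add
    (isQuadBounded_l2Inner _ (hM hc hD) hR)).add (isQuadBounded_l2Inner _ hD hR')

/-- First order operators whose leading coefficients may have linear growth. -/
theorem isQuadBounded_firstOrder (hs : ∀ j, HasBoundedDerivs (s j)) (hh : IsBddSmooth h)
    {α β : Fin d → ℕ} (hab : ∑ i, α i + ∑ i, β i ≤ 2 * q) :
    IsQuadBounded q fun φ =>
      2 * l2Inner d (weighted α β φ) (weighted α β (firstOrder s h φ)) := by
  have hD := (isOp_weighted α β).mono hab
  have hR := (isOp_commutator_weighted hs hh.hasBoundedDerivs α β).mono hab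
  have hc := isBddSmooth_adjointCoeff hs hh
  have hadj := l2Inner_firstOrder hs hh
  set B := firstOrder s h
  set c := adjointCoeff s h
  generalize weighted α β = D at *
  have hRB : ∀ φ, D (B φ) = B (D φ) + (D * B - B * D) φ := fun φ => by
    simp only [sub_apply, mul_apply_eq_comp]; abel
  generalize D * B - B * D = R at *
  -- Since `B* = -B + c`, the form `2 ⟨u, B u⟩` equals `⟨c u, u⟩`, taken at `u = D φ`.
  have key : ∀ φ, 2 * l2Inner d (D φ) (D (B φ)) =
      1 * l2Inner d ((mulOp c * D) φ) (D φ) + 2 * l2Inner d (D φ) (R φ) := by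
    intro φ
    have h1 := hadj (D φ) (D φ)
    rw [l2Inner_comm (B (D φ))] at h1
    rw [hRB, map_add, mul_apply_eq_comp]
    linarith
  simp only [key]
  exact (isQuadBounded_l2Inner _ (by simpa using (IsOp.mul_bdd hc).comp hD) hD).add
    (isQuadBounded_l2Inner _ hD hR)

end

section

/-! ### The operators `L` and `A_i` on `𝓢(ℝᵈ)` -/

variable {d : ℕ}

/-- The operator `L` on `𝓢(ℝᵈ)`. -/
def schwartzL (σ : E d → Matrix (Fin d) (Fin d) ℝ) (f : Fin d → E d → ℝ) (g : E d → ℝ) : Op d :=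
  (1 / 2 : ℝ) • ∑ i, ∑ j, mulOp (fun x => (σ x * (σ x).transpose) i j) * (pderiv i * pderiv j)
    + firstOrder f g

/-- The operator `A_i` on `𝓢(ℝᵈ)`. -/
def schwartzA (σ : E d → Matrix (Fin d) (Fin d) ℝ) (h : Fin d → E d → ℝ) (i : Fin d) : Op d :=
  firstOrder (fun j x => σ x j i) (h i)

/-- Separates the orders in the square: the second order part has coefficients `s_j s_k`, which sum
over the columns of `σ` to `σ σᵗ`, and all other coefficients are bounded. -/
theorem firstOrder_sq_apply {s : Fin d → E d → ℝ} {h : E d → ℝ}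
    (hs : ∀ j, IsBddSmooth (s j)) (hh : IsBddSmooth h) (φ : 𝓢(E d, ℝ)) (x : E d) :
    firstOrder s h (firstOrder s h φ) x =
      ∑ j, ∑ k, s j x * s k x * pderiv j (pderiv k φ) x +
      ∑ k, (∑ j, s j x * partialDeriv j (s k) x + 2 * (h x * s k x)) * pderiv k φ x +
      (∑ j, s j x * partialDeriv j h x + h x * h x) * φ x := by
  have hs' := fun j => (hs j).hasTemperateGrowth
  have hp : ∀ j, pderiv j (firstOrder s h φ) x = ∑ k, s k x * pderiv k (pderiv j φ) x +
      h x * pderiv j φ x + (∑ k, partialDeriv j (s k) x * pderiv k φ x +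
        partialDeriv j h x * φ x) := by
    intro j
    have := congrArg (fun T : Op d => T φ x)
      (pderiv_mul_firstOrder (fun j => (hs j).hasBoundedDerivs) hh.hasBoundedDerivs j)
    simp only [add_apply, mul_apply_eq_comp] at this
    rw [this, firstOrder_apply hs' hh.hasTemperateGrowth,
      firstOrder_apply (fun k => ((hs k).partialDeriv j).hasTemperateGrowth)
        (hh.partialDeriv j).hasTemperateGrowth]
  have hcomm : ∀ j k, pderiv k (pderiv j φ) x = pderiv j (pderiv k φ) x := fun j k =>
    congrArg (fun T : Op d => T φ x) (pderiv_comm k j)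
  rw [firstOrder_apply hs' hh.hasTemperateGrowth, firstOrder_apply hs' hh.hasTemperateGrowth]
  have e1 : ∑ j, s j x * pderiv j (firstOrder s h φ) x =
      ∑ j, ∑ k, s j x * s k x * pderiv j (pderiv k φ) x + ∑ k, h x * s k x * pderiv k φ x +
      ∑ k, (∑ j, s j x * partialDeriv j (s k) x) * pderiv k φ x +
      (∑ j, s j x * partialDeriv j h x) * φ x := by
    have e2 : ∑ k, (∑ j, s j x * partialDeriv j (s k) x) * pderiv k φ x =
        ∑ j, ∑ k, s j x * partialDeriv j (s k) x * pderiv k φ x := by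
      rw [Finset.sum_comm]
      simp only [Finset.sum_mul]
    rw [e2, Finset.sum_mul, ← Finset.sum_add_distrib, ← Finset.sum_add_distrib,
      ← Finset.sum_add_distrib]
    refine Finset.sum_congr rfl fun j _ => ?_
    rw [hp]
    simp only [mul_add, Finset.mul_sum, hcomm, ← mul_assoc]
    ring
  rw [e1]
  simp only [add_mul, Finset.sum_add_distrib, mul_add, Finset.mul_sum, two_mul, ← mul_assoc]
  ring

variable {σ : E d → Matrix (Fin d) (Fin d) ℝ} {f h : Fin d → E d → ℝ} {g : E d → ℝ}

theorem isBddSmooth_sq (hσ : ∀ i j, IsBddSmooth fun x => σ x i j) (i j : Fin d) :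
    IsBddSmooth fun x => (σ x * (σ x).transpose) i j := by
  simp only [Matrix.mul_apply, Matrix.transpose_apply]
  exact .sum fun k _ => (hσ i k).mul (hσ j k)

/-- `2 L = ∑ᵢ A_i² + 2 B` with a first order operator `B`. -/
theorem exists_two_smul_schwartzL_eq (hσ : ∀ i j, IsBddSmooth fun x => σ x i j)
    (hh : ∀ j, IsBddSmooth (h j)) (hg : IsBddSmooth g) (hf : ∀ j, HasBoundedDerivs (f j)) :
    ∃ (s : Fin d → E d → ℝ) (c : E d → ℝ), (∀ j, HasBoundedDerivs (s j)) ∧ IsBddSmooth c ∧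
      ∀ φ, (2 : ℝ) • schwartzL σ f g φ =
        ∑ i, schwartzA σ h i (schwartzA σ h i φ) + (2 : ℝ) • firstOrder s c φ := by
  -- `u i k` and `v i` are the first and zeroth order coefficients of `A_i²`; half their sums over
  -- `i` are subtracted from `f` and `g`.
  let u : Fin d → Fin d → E d → ℝ := fun i k x =>
    ∑ j, σ x j i * partialDeriv j (fun x => σ x k i) x + 2 * (h i x * σ x k i)
  let v : Fin d → E d → ℝ := fun i x =>
    ∑ j, σ x j i * partialDeriv j (h i) x + h i x * h i x
  have hu : ∀ i k, IsBddSmooth (u i k) := fun i k =>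
    (IsBddSmooth.sum fun j _ => (hσ j i).mul ((hσ k i).partialDeriv j)).add
      (((hh i).mul (hσ k i)).const_mul 2)
  have hv : ∀ i, IsBddSmooth (v i) := fun i =>
    (IsBddSmooth.sum fun j _ => (hσ j i).mul ((hh i).partialDeriv j)).add ((hh i).mul (hh i))
  -- The correction to `f_k` is bounded and smooth, so the new drift still has bounded derivatives.
  have hs : ∀ k, HasBoundedDerivs fun x => f k x + (-1 / 2) * ∑ i, u i k x := fun k =>
    (hf k).add ((IsBddSmooth.sum fun i _ => hu i k).const_mul _).hasBoundedDerivs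
  have hc : IsBddSmooth fun x => g x + (-1 / 2) * ∑ i, v i x :=
    hg.add ((IsBddSmooth.sum fun i _ => hv i).const_mul _)
  refine ⟨_, _, hs, hc, fun φ => ?_⟩
  ext x
  have hA : ∀ i, schwartzA σ h i (schwartzA σ h i φ) x =
      ∑ j, ∑ k, σ x j i * σ x k i * pderiv j (pderiv k φ) x + ∑ k, u i k x * pderiv k φ x +
      v i x * φ x := fun i => firstOrder_sq_apply (fun j => hσ j i) (hh i) φ x
  have h2 : ∑ i, ∑ j, (σ x * (σ x).transpose) i j * pderiv i (pderiv j φ) x =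
      ∑ i, ∑ j, ∑ k, σ x j i * σ x k i * pderiv j (pderiv k φ) x := by
    simp only [Matrix.mul_apply, Matrix.transpose_apply, Finset.sum_mul]
    conv_rhs => rw [Finset.sum_comm]
    exact Finset.sum_congr rfl fun j _ => Finset.sum_comm
  have h3 : ∑ i, ∑ k, u i k x * pderiv k φ x = ∑ k, (∑ i, u i k x) * pderiv k φ x := by
    rw [Finset.sum_comm]
    simp only [Finset.sum_mul]
  have hL : schwartzL σ f g φ x =
      1 / 2 * ∑ i, ∑ j, (σ x * (σ x).transpose) i j * pderiv i (pderiv j φ) x +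
      (∑ j, f j x * pderiv j φ x + g x * φ x) := by
    simp only [schwartzL, add_apply, smul_apply, sum_apply, mul_apply_eq_comp,
      mulOp_apply (isBddSmooth_sq hσ _ _).hasTemperateGrowth, smul_eq_mul,
      firstOrder_apply (fun j => (hf j).hasTemperateGrowth) hg.hasTemperateGrowth]
  simp only [add_apply, smul_apply, sum_apply, smul_eq_mul, hA, hL, Finset.sum_add_distrib, h2, h3,
    firstOrder_apply (fun j => (hs j).hasTemperateGrowth) hc.hasTemperateGrowth, add_mul,
    mul_assoc (-1 / 2 : ℝ), ← Finset.mul_sum, ← Finset.sum_mul]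
  ring

/-- Order two is attained both by the second derivatives and by `f_j ∂_j`, where the linear growth
of `f_j` counts for one. -/
theorem isOp_schwartzL (hσ : ∀ i j, IsBddSmooth fun x => σ x i j)
    (hg : IsBddSmooth g) (hf : ∀ j, HasBoundedDerivs (f j)) : IsOp 2 (schwartzL σ f g) :=
  (IsOp.smul _ (.sum fun i _ => .sum fun j _ => ((IsOp.mul_bdd (isBddSmooth_sq hσ i j)).comp
    ((IsOp.deriv i).comp (IsOp.deriv j))).mono (by omega))).add
    (isOp_firstOrder_of_hasBoundedDerivs hf hg)

theorem isOp_schwartzA (hσ : ∀ i j, IsBddSmooth fun x => σ x i j)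
    (hh : ∀ j, IsBddSmooth (h j)) (i : Fin d) : IsOp 1 (schwartzA σ h i) :=
  isOp_firstOrder (fun j => hσ j i) (hh i)

/-- The monotonicity inequality for Schwartz functions. -/
theorem exists_monotonicity_schwartz (q : ℕ) (hσ : ∀ i j, IsBddSmooth fun x => σ x i j)
    (hh : ∀ j, IsBddSmooth (h j)) (hg : IsBddSmooth g) (hf : ∀ j, HasBoundedDerivs (f j)) :
    ∃ C : ℝ, ∀ φ : 𝓢(E d, ℝ), 2 * schwartzInner q φ (schwartzL σ f g φ) +
      ∑ i, schwartzInner q (schwartzA σ h i φ) (schwartzA σ h i φ) ≤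
        C * schwartzInner q φ φ := by
  obtain ⟨s, c, hs, hc, hL⟩ := exists_two_smul_schwartzL_eq hσ hh hg hf
  have key : IsQuadBounded q fun φ : 𝓢(E d, ℝ) => ∑ ab ∈ indexSet d q,
      (∑ i, (l2Inner d (weighted ab.1 ab.2 φ)
          (weighted ab.1 ab.2 (schwartzA σ h i (schwartzA σ h i φ))) +
        l2Inner d (weighted ab.1 ab.2 (schwartzA σ h i φ))
          (weighted ab.1 ab.2 (schwartzA σ h i φ))) +
      2 * l2Inner d (weighted ab.1 ab.2 φ) (weighted ab.1 ab.2 (firstOrder s c φ))) := by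
    refine .sum fun ab hab => .add (.sum fun i _ => ?_) ?_
    · exact isQuadBounded_firstOrder_sq (fun j => hσ j i) (hh i)
        ((isOp_weighted ab.1 ab.2).mono ((mem_indexSet _ _).1 hab))
    · exact isQuadBounded_firstOrder hs hc ((mem_indexSet _ _).1 hab)
  obtain ⟨C, hC⟩ := key
  refine ⟨C, fun φ => le_trans (le_of_eq ?_) ((hC φ).trans_eq (by rw [norm_toPre_sq]))⟩
  have hinner : ∀ u v : 𝓢(E d, ℝ), schwartzInner q u v =
      ∑ ab ∈ indexSet d q, l2Inner d (weighted ab.1 ab.2 u) (weighted ab.1 ab.2 v) :=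
    schwartzInner_eq q
  have h2 : ∀ D : Op d, 2 * l2Inner d (D φ) (D (schwartzL σ f g φ)) =
      ∑ i, l2Inner d (D φ) (D (schwartzA σ h i (schwartzA σ h i φ))) +
        2 * l2Inner d (D φ) (D (firstOrder s c φ)) := by
    intro D
    rw [← smul_eq_mul, ← map_smul, ← map_smul, hL, map_add, map_add, map_sum, map_sum, map_smul,
      map_smul, smul_eq_mul]
  simp only [hinner, Finset.mul_sum, h2]
  rw [Finset.sum_comm, ← Finset.sum_add_distrib]
  refine Finset.sum_congr rfl fun ab _ => ?_
  rw [Finset.sum_add_distrib]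
  ring

/-! ### Extension to the completions -/

theorem norm_ofSchwartz (p : ℕ) (φ : 𝓢(E d, ℝ)) : ‖ofSchwartz p φ‖ = ‖toPre p φ‖ :=
  UniformSpace.Completion.norm_coe _

/-- An operator of order at most `2 (p - q)` extends to a bounded operator `𝓢_p → 𝓢_q`. -/
theorem IsOp.exists_extension {p q k : ℕ} {T : Op d} (hT : IsOp k T) (hk : 2 * q + k ≤ 2 * p) :
    ∃ F : SSpace d p →L[ℝ] SSpace d q, ∀ φ, F (ofSchwartz p φ) = ofSchwartz q (T φ) := by
  obtain ⟨C, -, hC⟩ := hT.norm_toPre_le hk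
  let T₀ : PreS d p →L[ℝ] SSpace d q := LinearMap.mkContinuous
    ((UniformSpace.Completion.toComplL : PreS d q →L[ℝ] SSpace d q).toLinearMap ∘ₗ
      (toPre q).toLinearMap ∘ₗ T.toLinearMap ∘ₗ (toPre p).symm.toLinearMap) C (by
    intro φ
    obtain ⟨φ, rfl⟩ := (toPre p).surjective φ
    exact (norm_ofSchwartz q (T φ)).trans_le (hC φ))
  exact ⟨T₀.extend (UniformSpace.Completion.toComplL : PreS d p →L[ℝ] SSpace d p), fun φ =>
    ContinuousLinearMap.extend_eq _ UniformSpace.Completion.denseRange_coe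
      (UniformSpace.Completion.isUniformInducing_coe _) (toPre p φ)⟩

theorem continuous_toTD_apply {p : ℕ} (ψ : 𝓢(E d, ℝ)) :
    Continuous fun φ : SSpace d p => toTD φ ψ := by
  simp only [toTD_apply]
  fun_prop

/-- The embedding of `𝓢(ℝᵈ)` in `𝓢'(ℝᵈ)`. -/
def schwartzToTD (d : ℕ) : 𝓢(E d, ℝ) →ₗ[ℝ] TD d where
  toFun φ := (innerSL ℝ (toLpCLM ℝ ℝ 2 volume φ)).comp (toLpCLM ℝ ℝ 2 volume)
  map_add' φ ψ := by rw [map_add, map_add, ContinuousLinearMap.add_comp]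
  map_smul' c φ := by rw [map_smul, map_smul]; rfl

/-- The distribution defined by a Schwartz function does not depend on `p`; the form on the right is
linear in `φ`, as needed to pass sums through the operators. -/
theorem toTD_ofSchwartz_eq (p : ℕ) (φ : 𝓢(E d, ℝ)) :
    toTD (ofSchwartz p φ) = schwartzToTD d φ := by
  rw [toTD, toL2_ofSchwartz]
  rfl

theorem tdDeriv_schwartzToTD (j : Fin d) (φ : 𝓢(E d, ℝ)) :
    tdDeriv j (schwartzToTD d φ) = schwartzToTD d (pderiv j φ) := by
  simpa only [toTD_ofSchwartz_eq] using tdDeriv_ofSchwartz (p := 0) j φ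

theorem tdMul_schwartzToTD {a : E d → ℝ} (ha : a.HasTemperateGrowth) (φ : 𝓢(E d, ℝ)) :
    tdMul a (schwartzToTD d φ) = schwartzToTD d (mulOp a φ) := by
  have := tdMul_ofSchwartz (p := 0) ha φ
  rwa [toTD_ofSchwartz_eq, toTD_ofSchwartz_eq] at this

theorem opA_schwartzToTD (hσ : ∀ i j, IsBddSmooth fun x => σ x i j)
    (hh : ∀ j, IsBddSmooth (h j)) (i : Fin d) (φ : 𝓢(E d, ℝ)) :
    opA σ h i (schwartzToTD d φ) = schwartzToTD d (schwartzA σ h i φ) := by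
  simp only [opA, schwartzA, firstOrder, tdDeriv_schwartzToTD,
    tdMul_schwartzToTD (hσ _ i).hasTemperateGrowth, tdMul_schwartzToTD (hh i).hasTemperateGrowth,
    add_apply, sum_apply, mul_apply_eq_comp, map_add, map_sum]

theorem opL_schwartzToTD (hσ : ∀ i j, IsBddSmooth fun x => σ x i j)
    (hg : IsBddSmooth g) (hf : ∀ j, HasBoundedDerivs (f j)) (φ : 𝓢(E d, ℝ)) :
    opL σ f g (schwartzToTD d φ) = schwartzToTD d (schwartzL σ f g φ) := by
  simp only [opL, schwartzL, firstOrder, tdDeriv_schwartzToTD,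
    tdMul_schwartzToTD (isBddSmooth_sq hσ _ _).hasTemperateGrowth,
    tdMul_schwartzToTD (hf _).hasTemperateGrowth, tdMul_schwartzToTD hg.hasTemperateGrowth,
    add_apply, sum_apply, smul_apply, mul_apply_eq_comp, map_add, map_sum, map_smul, add_assoc]

theorem continuous_opA_toTD_apply {p : ℕ} (i : Fin d) (ψ : 𝓢(E d, ℝ)) :
    Continuous fun φ : SSpace d p => opA σ h i (toTD φ) ψ := by
  simp only [opA, tdMul, tdDeriv, add_apply, sum_apply, ContinuousLinearMap.comp_apply, neg_apply]
  exact (continuous_finsetSum _ fun j _ => (continuous_toTD_apply _).neg).add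
    (continuous_toTD_apply _)

/-- By duality all derivatives and coefficients fall on the test function, so every term is `toTD φ`
evaluated at a fixed Schwartz function. -/
theorem continuous_opL_toTD_apply {p : ℕ} (ψ : 𝓢(E d, ℝ)) :
    Continuous fun φ : SSpace d p => opL σ f g (toTD φ) ψ := by
  simp only [opL, tdMul, tdDeriv, add_apply, sum_apply, smul_apply, ContinuousLinearMap.comp_apply,
    neg_apply, smul_eq_mul]
  refine Continuous.add (Continuous.add (continuous_const.mul ?_) ?_) (continuous_toTD_apply _)
  · exact continuous_finsetSum _ fun i _ => continuous_finsetSum _ fun j _ =>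
      (continuous_toTD_apply _).neg.neg
  · exact continuous_finsetSum _ fun j _ => (continuous_toTD_apply _).neg

end

end HermiteSobolev

/-! ### The monotonicity inequality on `𝓢_p` -/

open HermiteSobolev in
theorem mainTheorem4 (d p q : ℕ) (hq : 0 < q) (hqp : q + 1 ≤ p)
    (σ : HermiteSobolev.E d → Matrix (Fin d) (Fin d) ℝ)
    (f h : Fin d → HermiteSobolev.E d → ℝ) (g : HermiteSobolev.E d → ℝ)
    (hσ : ∀ i j, HermiteSobolev.IsBoundedFun (fun x => σ x i j) ∧
      HermiteSobolev.HasBoundedDerivs (fun x => σ x i j))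
    (hh : ∀ j, HermiteSobolev.IsBoundedFun (h j) ∧ HermiteSobolev.HasBoundedDerivs (h j))
    (hg : HermiteSobolev.IsBoundedFun g ∧ HermiteSobolev.HasBoundedDerivs g)
    (hf : ∀ j, HermiteSobolev.HasBoundedDerivs (f j)) :
    ∃ C : ℝ, 0 < C ∧ ∀ φ : HermiteSobolev.SSpace d p,
      ∃ (Lφ : HermiteSobolev.SSpace d q) (Aφ : Fin d → HermiteSobolev.SSpace d q),
        HermiteSobolev.toTD Lφ = HermiteSobolev.opL σ f g (HermiteSobolev.toTD φ) ∧
        (∀ i, HermiteSobolev.toTD (Aφ i) = HermiteSobolev.opA σ h i (HermiteSobolev.toTD φ)) ∧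
        2 * inner ℝ (HermiteSobolev.inclusion d ((Nat.le_succ q).trans hqp) φ) Lφ +
            ∑ i, ‖Aφ i‖ ^ 2 ≤
          C * ‖HermiteSobolev.inclusion d ((Nat.le_succ q).trans hqp) φ‖ ^ 2 := by
  have hσ' : ∀ i j, IsBddSmooth fun x => σ x i j := fun i j => isBddSmooth_iff.2 (hσ i j)
  have hh' : ∀ j, IsBddSmooth (h j) := fun j => isBddSmooth_iff.2 (hh j)
  have hg' : IsBddSmooth g := isBddSmooth_iff.2 hg
  obtain ⟨C, hC⟩ := exists_monotonicity_schwartz q hσ' hh' hg' hf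
  -- `L` has order two, so its extension requires `2 q + 2 ≤ 2 p`, which is `hqp`.
  obtain ⟨FL, hFL⟩ := (isOp_schwartzL hσ' hg' hf).exists_extension
    (p := p) (q := q) (by omega)
  choose FA hFA using fun i => (isOp_schwartzA hσ' hh' i).exists_extension
    (p := p) (q := q) (by omega)
  -- The constant obtained on Schwartz functions carries no sign; the maximum with `1` makes it
  -- positive.
  refine ⟨max C 1, lt_max_of_lt_right one_pos, fun φ => ⟨FL φ, fun i => FA i φ, ?_, fun i => ?_, ?_⟩⟩
  · ext ψ
    refine (denseRange_ofSchwartz d p).induction_on φ (isClosed_eq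
      ((continuous_toTD_apply ψ).comp FL.continuous) (continuous_opL_toTD_apply ψ)) fun φ => ?_
    rw [hFL, toTD_ofSchwartz_eq, toTD_ofSchwartz_eq, opL_schwartzToTD hσ' hg' hf]
  · ext ψ
    refine (denseRange_ofSchwartz d p).induction_on φ (isClosed_eq
      ((continuous_toTD_apply ψ).comp (FA i).continuous) (continuous_opA_toTD_apply i ψ)) fun φ => ?_
    beta_reduce
    rw [hFA, toTD_ofSchwartz_eq, toTD_ofSchwartz_eq, opA_schwartzToTD hσ' hh']
  -- Both sides are continuous in the norm of `𝓢_p`, so the inequality is a closed condition and it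
  -- suffices to check it on Schwartz functions.
  · refine (denseRange_ofSchwartz d p).induction_on φ
      (isClosed_le (by fun_prop) (by fun_prop)) fun φ => ?_
    simp only [hFL, hFA, inclusion_ofSchwartz, ← real_inner_self_eq_norm_sq, inner_ofSchwartz]
    refine (hC φ).trans (mul_le_mul_of_nonneg_right (le_max_left _ _) ?_)
    rw [← norm_toPre_sq]
    exact sq_nonneg _

end
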